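/- A constraint graph is a finite undirected multigraph (loops and parallel edges allowed) whose edges have weight $1$ (red) or $2$ (blue). Counting a loop twice, a vertex is an AND vertex if exactly one blue and two red edge ends are incident to it, and an OR vertex if exactly three blue and no red edge ends are incident to it; the graph is an AND/OR graph if each of its vertices is an AND or an OR vertex. An orientation assigns to each edge $xy$ one of the arcs $(x,y)$, $(y,x)$ (so a loop has only one orientation); it is feasible if at every vertex the total weight of the entering arcs is at least $2$. Two feasible orientations are connected if one can be transformed into the other by reversing the direction of one edge at a time so that all intermediate orientations are feasible. The problem C2C asks, given a constraint graph and two feasible orientations $A_{\mathrm{ini}}$ and $A_{\mathrm{tar}}$ of it, whether $A_{\mathrm{ini}}$ and $A_{\mathrm{tar}}$ are connected. The problem C2E asks, given a constraint graph, a feasible orientation $A_{\mathrm{ini}}$ of it and an edge $e$, whether $A_{\mathrm{ini}}$ is connected to some feasible orientation in which the direction of $e$ differs from its direction in $A_{\mathrm{ini}}$. **Theorem.** Each of C2C and C2E, restricted to AND/OR graphs, can be decided by an algorithm whose running time on AND/OR graphs with $n$ vertices and $k$ OR vertices is $2^{O(k)}\cdot\mathrm{poly}(n)$; that is, there are a constant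 $c$ and a polynomial $q$ such that the running time is at most $2^{ck}\,q(n)$ for all $n$ and $k$. -/

import Mathlib

/-! ### Constraint graphs, orientations and reconfiguration -/

/-- A constraint graph: a finite undirected multigraph, loops and parallel edges allowed, with
vertices `0, …, n - 1`, edges `0, …, m - 1`, and edge weights one ("red") or two ("blue"). -/
structure ConstraintGraph where
  /-- number of vertices -/
  n : ℕ
  /-- number of edges -/
  m : ℕ
  /-- the unordered pair of end vertices of an edge -/
  ends : Fin m → Sym2 (Fin n)
  /-- the weight of an edge -/
  weight : Fin m → ℕ
  weight_eq : ∀ e, weight e = 1 ∨ weight e = 2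

namespace ConstraintGraph

variable (G : ConstraintGraph)

/-- How often the vertex `v` is an end of the edge `e`: a loop at `v` counts twice. -/
def incidence (e : Fin G.m) (v : Fin G.n) : ℕ :=
  (if v ∈ G.ends e then 1 else 0) + (if G.ends e = s(v, v) then 1 else 0)

/-- The number of edges of weight `w` at `v` (loops counted twice). -/
def degreeOfWeight (w : ℕ) (v : Fin G.n) : ℕ :=
  ∑ e : Fin G.m, if G.weight e = w then G.incidence e v else 0

/-- An AND vertex has degree three, with exactly one blue and two red edge ends. -/
def IsAndVertex (v : Fin G.n) : Prop :=
  G.degreeOfWeight 2 v = 1 ∧ G.degreeOfWeight 1 v = 2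

/-- An OR vertex has degree three, with three blue edge ends. -/
def IsOrVertex (v : Fin G.n) : Prop :=
  G.degreeOfWeight 2 v = 3 ∧ G.degreeOfWeight 1 v = 0

instance (v : Fin G.n) : Decidable (G.IsOrVertex v) :=
  inferInstanceAs (Decidable (_ ∧ _))

/-- AND/OR graphs: every vertex is an AND vertex or an OR vertex. -/
def IsAndOr : Prop :=
  ∀ v, G.IsAndVertex v ∨ G.IsOrVertex v

/-- The number of OR vertices. -/
def numOr : ℕ :=
  (Finset.univ.filter fun v : Fin G.n => G.IsOrVertex v).card

/-- An orientation replaces each edge by one arc `(tail, head)` with the same end vertices.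
A loop has only one orientation. -/
structure Orientation where
  /-- the arc that replaces an edge -/
  arc : Fin G.m → Fin G.n × Fin G.n
  ends_arc : ∀ e, s((arc e).1, (arc e).2) = G.ends e

end ConstraintGraph

namespace ConstraintGraph.Orientation

variable {G : ConstraintGraph}

/-- The total weight of the arcs that enter `v`. -/
def inWeight (A : G.Orientation) (v : Fin G.n) : ℕ :=
  ∑ e : Fin G.m, if (A.arc e).2 = v then G.weight e else 0

/-- Feasible orientations, also called configurations. -/
def Feasible (A : G.Orientation) : Prop :=
  ∀ v, 2 ≤ A.inWeight v

/-- `B` equals `A` or is obtained from `A` by reversing a single arc. -/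
def Adjacent (A B : G.Orientation) : Prop :=
  A = B ∨ ∃ e, B.arc = Function.update A.arc e (A.arc e).swap

/-- There is a sequence of feasible orientations from `A` to `B` in which consecutive members
are adjacent. -/
def Reconfigurable (A B : G.Orientation) : Prop :=
  A.Feasible ∧ B.Feasible ∧
    Relation.ReflTransGen (fun C D => C.Feasible ∧ D.Feasible ∧ C.Adjacent D) A B

end ConstraintGraph.Orientation

/-! ### Random access programs and their running time -/

namespace RAM

/-- A memory state: registers, and arrays of unbounded length, holding natural numbers. -/
structure State where
  /-- the registers -/
  reg : ℕ → ℕ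
  /-- `arr a i` is cell `i` of array `a` -/
  arr : ℕ → ℕ → ℕ

/-- Write `v` into register `x`. -/
def State.setReg (s : State) (x v : ℕ) : State :=
  { s with reg := Function.update s.reg x v }

/-- Write `v` into cell `i` of array `a`. -/
def State.setArr (s : State) (a i v : ℕ) : State :=
  { s with arr := Function.update s.arr a (Function.update (s.arr a) i v) }

/-- Structured programs of a random access machine. A program names finitely many registers and
arrays; only array cells are addressed indirectly. The arithmetic is addition and truncated
subtraction; there is no multiplication, so that in `t` steps the largest number in the memory
grows at most by a factor `2 ^ t` (up to the constants in the program), and unit-cost running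
time is polynomially related to running time on multitape Turing machines. -/
inductive Prog where
  /-- `x := c` -/
  | const (x c : ℕ)
  /-- `x := y` -/
  | copy (x y : ℕ)
  /-- `x := y + z` -/
  | add (x y z : ℕ)
  /-- `x := y - z`, which is `0` if `y < z` -/
  | sub (x y z : ℕ)
  /-- `x := a[i]`, where `i` is a register -/
  | load (x a i : ℕ)
  /-- `a[i] := y`, where `i` and `y` are registers -/
  | store (a i y : ℕ)
  /-- first `p`, then `q` -/
  | seq (p q : Prog)
  /-- if `x ≠ 0` then `p` else `q` -/
  | ite (x : ℕ) (p q : Prog)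
  /-- while `x ≠ 0` do `p` -/
  | loop (x : ℕ) (p : Prog)

/-- `Exec p s t s₁`: started in state `s`, the program `p` halts in state `s₁` after `t` steps.
Each elementary instruction and each test of a register is one step. -/
inductive Exec : Prog → State → ℕ → State → Prop
  | const (x c : ℕ) (s : State) : Exec (.const x c) s 1 (s.setReg x c)
  | copy (x y : ℕ) (s : State) : Exec (.copy x y) s 1 (s.setReg x (s.reg y))
  | add (x y z : ℕ) (s : State) : Exec (.add x y z) s 1 (s.setReg x (s.reg y + s.reg z))
  | sub (x y z : ℕ) (s : State) : Exec (.sub x y z) s 1 (s.setReg x (s.reg y - s.reg z))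
  | load (x a i : ℕ) (s : State) : Exec (.load x a i) s 1 (s.setReg x (s.arr a (s.reg i)))
  | store (a i y : ℕ) (s : State) : Exec (.store a i y) s 1 (s.setArr a (s.reg i) (s.reg y))
  | seq {p q : Prog} {s s₁ s₂ : State} {t₁ t₂ : ℕ} :
      Exec p s t₁ s₁ → Exec q s₁ t₂ s₂ → Exec (.seq p q) s (t₁ + t₂) s₂
  | iteTrue {x : ℕ} {p q : Prog} {s s₁ : State} {t : ℕ} :
      s.reg x ≠ 0 → Exec p s t s₁ → Exec (.ite x p q) s (t + 1) s₁
  | iteFalse {x : ℕ} {p q : Prog} {s s₁ : State} {t : ℕ} :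
      s.reg x = 0 → Exec q s t s₁ → Exec (.ite x p q) s (t + 1) s₁
  | loopDone {x : ℕ} {p : Prog} {s : State} :
      s.reg x = 0 → Exec (.loop x p) s 1 s
  | loopStep {x : ℕ} {p : Prog} {s s₁ s₂ : State} {t₁ t₂ : ℕ} :
      s.reg x ≠ 0 → Exec p s t₁ s₁ → Exec (.loop x p) s₁ t₂ s₂ →
        Exec (.loop x p) s (t₁ + t₂ + 1) s₂

/-- Programs are deterministic: the final state and the number of steps are determined by the
initial state. -/
theorem Exec.deterministic {p : Prog} {s s₁ : State} {t₁ : ℕ} (h₁ : Exec p s t₁ s₁) :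
    ∀ {t₂ : ℕ} {s₂ : State}, Exec p s t₂ s₂ → t₁ = t₂ ∧ s₁ = s₂ := by
  induction h₁ with
  | const | copy | add | sub | load | store => intro t₂ s₂ h; cases h; exact ⟨rfl, rfl⟩
  | seq _ _ ih₁ ih₂ =>
    intro t₂ s₂ h
    cases h with
    | seq a b =>
      obtain ⟨rfl, rfl⟩ := ih₁ a
      obtain ⟨rfl, rfl⟩ := ih₂ b
      exact ⟨rfl, rfl⟩
  | iteTrue hx _ ih =>
    intro t₂ s₂ h
    cases h with
    | iteTrue _ a => obtain ⟨rfl, rfl⟩ := ih a; exact ⟨rfl, rfl⟩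
    | iteFalse hy _ => exact absurd hy hx
  | iteFalse hx _ ih =>
    intro t₂ s₂ h
    cases h with
    | iteTrue hy _ => exact absurd hx hy
    | iteFalse _ a => obtain ⟨rfl, rfl⟩ := ih a; exact ⟨rfl, rfl⟩
  | loopDone hx =>
    intro t₂ s₂ h
    cases h with
    | loopDone _ => exact ⟨rfl, rfl⟩
    | loopStep hy _ _ => exact absurd hx hy
  | loopStep hx _ _ ih₁ ih₂ =>
    intro t₂ s₂ h
    cases h with
    | loopDone hy => exact absurd hy hx
    | loopStep _ a b =>
      obtain ⟨rfl, rfl⟩ := ih₁ a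
      obtain ⟨rfl, rfl⟩ := ih₂ b
      exact ⟨rfl, rfl⟩

/-- The program `p` decides `yes` on the instances that satisfy `valid`, with an instance `I`
stored in the memory as `input I`: it halts within `bound I` steps, with `1` in register `0` if
the answer is yes and `0` if the answer is no. -/
def Prog.DecidesInTime {Inst : Type} (p : Prog) (input : Inst → State) (valid yes : Inst → Prop)
    (bound : Inst → ℕ) : Prop :=
  ∀ I, valid I → ∃ (t : ℕ) (s : State), Exec p (input I) t s ∧ t ≤ bound I ∧
    (yes I → s.reg 0 = 1) ∧ (¬ yes I → s.reg 0 = 0)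

/-- The infinite array that starts with the values of `f`, followed by zeros. -/
def ofFin {m : ℕ} (f : Fin m → ℕ) : ℕ → ℕ :=
  fun i => if h : i < m then f ⟨i, h⟩ else 0

/-- The infinite list that starts with `l`, followed by `d`s. -/
def ofList {α : Type} (d : α) (l : List α) : ℕ → α :=
  fun i => l.getD i d

end RAM

/-! ### The two decision problems -/

/-- Instances of configuration-to-configuration. -/
structure C2C where
  G : ConstraintGraph
  ini : G.Orientation
  tar : G.Orientation
  ini_feasible : ini.Feasible
  tar_feasible : tar.Feasible

/-- Can `ini` be reconfigured into `tar`? -/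
def C2C.IsYes (I : C2C) : Prop :=
  I.ini.Reconfigurable I.tar

/-- The input as an edge list: registers `0, 1` hold the numbers of vertices and edges, and
arrays `0, …, 4` hold, for each edge, the tail and the head of its arc in `ini`, its weight, and
the tail and the head of its arc in `tar`. All other memory cells are `0`. -/
def C2C.input (I : C2C) : RAM.State where
  reg := RAM.ofList 0 [I.G.n, I.G.m]
  arr := RAM.ofList (fun _ => 0)
    [RAM.ofFin fun e => ((I.ini.arc e).1 : ℕ), RAM.ofFin fun e => ((I.ini.arc e).2 : ℕ),
      RAM.ofFin I.G.weight,
      RAM.ofFin fun e => ((I.tar.arc e).1 : ℕ), RAM.ofFin fun e => ((I.tar.arc e).2 : ℕ)]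

/-- Instances of configuration-to-edge. -/
structure C2E where
  G : ConstraintGraph
  ini : G.Orientation
  edge : Fin G.m
  ini_feasible : ini.Feasible

/-- Can `ini` be reconfigured into a configuration in which the given edge has a different
direction? -/
def C2E.IsYes (I : C2E) : Prop :=
  ∃ A : I.G.Orientation, A.Feasible ∧ I.ini.Reconfigurable A ∧ A.arc I.edge ≠ I.ini.arc I.edge

/-- The input as an edge list: registers `0, 1, 2` hold the number of vertices, the number of
edges and the index of the given edge, and arrays `0, 1, 2` hold, for each edge, the tail and the
head of its arc in `ini` and its weight. All other memory cells are `0`. -/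
def C2E.input (I : C2E) : RAM.State where
  reg := RAM.ofList 0 [I.G.n, I.G.m, (I.edge : ℕ)]
  arr := RAM.ofList (fun _ => 0)
    [RAM.ofFin fun e => ((I.ini.arc e).1 : ℕ), RAM.ofFin fun e => ((I.ini.arc e).2 : ℕ),
      RAM.ofFin I.G.weight]

/-! Fix the initial orientation and regard the two directions of an edge as complementary literals,
called darts. In an AND/OR graph an orientation is feasible exactly if no red and blue edge leave
the same vertex, which is a system of binary clauses, and every OR vertex is entered by an edge
(`Represents.feasible_iff`).

The solution graph of binary clauses is easy to describe. A literal is rigid if it lies on a cycle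
of implications through another literal. Changing one value at a time never changes a rigid literal
(`Rigid.mem_flip`). Conversely, two solutions that agree on the rigid literals are connected: among
the literals true only in the second, one that is maximal in the implication order can be made true
in the first (`IsSol.exists_flip`, `IsSol.connected`). Literals true in both remain true. Hence, if
a set U of darts contains a dart into each OR vertex, all solutions that contain U and the rigid
darts of the initial orientation are connected through feasible orientations. Such solutions exist
iff unit propagation from these darts yields no contradiction (`Consistent.exists_isSol`).

So it suffices to search through sets U of darts into OR vertices. With k OR vertices there are 3k
such darts (`card_isOrDart`), hence 2^(3k) sets. Moving between nested valid sets is sound, since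
each solution for the larger set is one for the smaller (`Reached.reconfigurable`). It is also
complete: when one edge is reversed, each OR vertex has a dart entering it both before and after, so
one can shrink to the common darts and grow again (`Reconfigurable.reached`). The target
orientation, or the reversed edge, is one more set of darts in a final consistency test.

The algorithm is a single expression with bounded loops and naive graph search. By `runs_compile` it
becomes a program whose running time is a fixed polynomial p in a bound on the loop lengths. These
are 2m ≤ 3n and 2^(3k), and p(2^(3k)(3n + 1)) ≤ 2^(3k deg p) p(3n + 1) by `eval_mul_le`. -/

namespace RAM

/-! ### Running programs with a bound on the number of steps -/

/-- `Runs p s C Q`: started in `s`, the program `p` halts within `C` steps in a state that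
satisfies `Q`. -/
def Runs (p : Prog) (s : State) (C : ℕ) (Q : State → Prop) : Prop :=
  ∃ t s', Exec p s t s' ∧ t ≤ C ∧ Q s'

theorem Runs.mono {p : Prog} {s : State} {C C' : ℕ} {Q Q' : State → Prop}
    (h : Runs p s C Q) (hC : C ≤ C') (hQ : ∀ s', Q s' → Q' s') : Runs p s C' Q' := by
  obtain ⟨t, s', h₁, h₂, h₃⟩ := h
  exact ⟨t, s', h₁, h₂.trans hC, hQ _ h₃⟩

theorem Runs.seq {p q : Prog} {s : State} {C C' : ℕ} {Q Q' : State → Prop}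
    (h : Runs p s C Q) (h' : ∀ s', Q s' → Runs q s' C' Q') :
    Runs (.seq p q) s (C + C') Q' := by
  obtain ⟨t, s', h₁, h₂, h₃⟩ := h
  obtain ⟨t', s'', h₁', h₂', h₃'⟩ := h' _ h₃
  exact ⟨_, _, .seq h₁ h₁', Nat.add_le_add h₂ h₂', h₃'⟩

theorem Runs.const {x c : ℕ} {s : State} {Q : State → Prop} (h : Q (s.setReg x c)) :
    Runs (.const x c) s 1 Q := ⟨_, _, .const _ _ _, le_rfl, h⟩

theorem Runs.copy {x y : ℕ} {s : State} {Q : State → Prop} (h : Q (s.setReg x (s.reg y))) :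
    Runs (.copy x y) s 1 Q := ⟨_, _, .copy _ _ _, le_rfl, h⟩

theorem Runs.add {x y z : ℕ} {s : State} {Q : State → Prop}
    (h : Q (s.setReg x (s.reg y + s.reg z))) :
    Runs (.add x y z) s 1 Q := ⟨_, _, .add _ _ _ _, le_rfl, h⟩

theorem Runs.sub {x y z : ℕ} {s : State} {Q : State → Prop}
    (h : Q (s.setReg x (s.reg y - s.reg z))) :
    Runs (.sub x y z) s 1 Q := ⟨_, _, .sub _ _ _ _, le_rfl, h⟩

theorem Runs.load {x a i : ℕ} {s : State} {Q : State → Prop}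
    (h : Q (s.setReg x (s.arr a (s.reg i)))) :
    Runs (.load x a i) s 1 Q := ⟨_, _, .load _ _ _ _, le_rfl, h⟩

theorem Runs.store {a i y : ℕ} {s : State} {Q : State → Prop}
    (h : Q (s.setArr a (s.reg i) (s.reg y))) :
    Runs (.store a i y) s 1 Q := ⟨_, _, .store _ _ _ _, le_rfl, h⟩

theorem Runs.ite {x : ℕ} {p q : Prog} {s : State} {C : ℕ} {Q : State → Prop}
    (hp : s.reg x ≠ 0 → Runs p s C Q) (hq : s.reg x = 0 → Runs q s C Q) :
    Runs (.ite x p q) s (C + 1) Q := by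
  by_cases hx : s.reg x = 0
  · obtain ⟨t, s', h₁, h₂, h₃⟩ := hq hx
    exact ⟨_, _, .iteFalse hx h₁, by omega, h₃⟩
  · obtain ⟨t, s', h₁, h₂, h₃⟩ := hp hx
    exact ⟨_, _, .iteTrue hx h₁, by omega, h₃⟩

/-- A loop whose guard counts down: the invariant `P i` holds when `i` rounds are left. -/
theorem Runs.loop {x : ℕ} {p : Prog} {C : ℕ} (P : ℕ → State → Prop)
    (hx : ∀ i s, P i s → s.reg x = i)
    (hp : ∀ i s, P (i + 1) s → Runs p s C (P i)) :
    ∀ n s, P n s → Runs (.loop x p) s (n * (C + 1) + 1) (P 0) := by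
  intro n
  induction n with
  | zero => exact fun s h => ⟨_, _, .loopDone (hx _ _ h), by omega, h⟩
  | succ n ih =>
    intro s h
    obtain ⟨t, s', h₁, h₂, h₃⟩ := hp _ _ h
    obtain ⟨t', s'', h₁', h₂', h₃'⟩ := ih _ h₃
    refine ⟨_, _, .loopStep (by rw [hx _ _ h]; omega) h₁ h₁', ?_, h₃'⟩
    rw [Nat.succ_mul]
    omega

/-! ### Memory below a threshold, and counted loops -/

@[simp] theorem State.setReg_reg (s : State) (x v y : ℕ) :
    (s.setReg x v).reg y = if y = x then v else s.reg y := by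
  simp [State.setReg, Function.update_apply]

@[simp] theorem State.setReg_arr (s : State) (x v : ℕ) : (s.setReg x v).arr = s.arr := rfl

@[simp] theorem State.setArr_reg (s : State) (a i v : ℕ) : (s.setArr a i v).reg = s.reg := rfl

@[simp] theorem State.setArr_arr (s : State) (a i v b : ℕ) :
    (s.setArr a i v).arr b = if b = a then Function.update (s.arr a) i v else s.arr b := by
  simp [State.setArr, Function.update_apply]

/-- The memory below index `t` is the same in both states, except possibly at index `ρ`. -/
def Same (ρ t : ℕ) (s s' : State) : Prop :=
  ∀ r < t, r ≠ ρ → s'.reg r = s.reg r ∧ s'.arr r = s.arr r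

theorem Same.refl (ρ t : ℕ) (s : State) : Same ρ t s s := fun _ _ _ => ⟨rfl, rfl⟩

theorem Same.trans {ρ t : ℕ} {s s' s'' : State} (h : Same ρ t s s') (h' : Same ρ t s' s'') :
    Same ρ t s s'' :=
  fun r hr hρ => ⟨(h' r hr hρ).1.trans (h r hr hρ).1, (h' r hr hρ).2.trans (h r hr hρ).2⟩

theorem Same.mono {ρ t t' : ℕ} {s s' : State} (h : Same ρ t s s') (ht : t' ≤ t) :
    Same ρ t' s s' := fun r hr => h r (hr.trans_le ht)

theorem Same.of_self {ρ t : ℕ} {s s' : State} (h : Same t t s s') : Same ρ t s s' :=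
  fun r hr _ => h r hr hr.ne

theorem Same.setReg {ρ t : ℕ} {s s' : State} (h : Same ρ t s s') (x v : ℕ) :
    Same ρ t (s.setReg x v) (s'.setReg x v) := by
  intro r hr hρ
  simp only [State.setReg_reg, State.setReg_arr, (h r hr hρ).1, (h r hr hρ).2, and_self]

theorem Same.setReg_right {ρ t x : ℕ} {s s' : State} (h : Same ρ t s s')
    (hx : t ≤ x ∨ x = ρ) (v : ℕ) : Same ρ t s (s'.setReg x v) := by
  intro r hr hρ
  have : r ≠ x := by omega
  simpa [this] using h r hr hρ

theorem Same.setArr_right {ρ t : ℕ} {s s' : State} (h : Same ρ t s s') (i v : ℕ) :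
    Same ρ t s (s'.setArr ρ i v) := by
  intro r hr hρ
  simpa [hρ] using h r hr hρ

/-- Run `body` for `x = 0, …, N - 1`, where `N` is the content of register `N` at the beginning.
The registers `t`, `t + 1`, `t + 2` are used for bookkeeping, and `x` is restored. -/
def Prog.forTo (t x N : ℕ) (body : Prog) : Prog :=
  .seq (.copy t x) (.seq (.const x 0) (.seq (.copy (t + 1) N) (.seq (.const (t + 2) 1)
    (.seq (.loop (t + 1) (.seq body (.seq (.add x x (t + 2)) (.sub (t + 1) (t + 1) (t + 2)))))
      (.copy x t)))))

/-- `P` sees only register and array `ρ`, the only memory below `t` that may differ once `x` is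
restored. A round costs the body, an addition, a subtraction and a test; the six extra steps are
four initialisations, the last test and the restoring of `x`. -/
theorem Runs.forTo {ρ t x N n C : ℕ} {body : Prog} {s₀ : State} (P : ℕ → ℕ → (ℕ → ℕ) → Prop)
    (hρ : ρ < t) (hx : x < t) (hxρ : x ≠ ρ) (hN : N < t) (hNx : N ≠ x) (hn : s₀.reg N = n)
    (hbody : ∀ i < n, ∀ s, Same ρ t (s₀.setReg x i) s → P i (s.reg ρ) (s.arr ρ) →
      Runs body s C fun s' => Same ρ (t + 3) s s' ∧ P (i + 1) (s'.reg ρ) (s'.arr ρ))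
    (h₀ : P 0 (s₀.reg ρ) (s₀.arr ρ)) :
    Runs (.forTo t x N body) s₀ (n * (C + 3) + 6) fun s' =>
      Same ρ t s₀ s' ∧ P n (s'.reg ρ) (s'.arr ρ) := by
  -- With `k` rounds left, `x` holds `n - k`; `k ≤ n` keeps the truncated subtraction exact.
  set J : ℕ → State → Prop := fun k s => k ≤ n ∧ Same ρ t (s₀.setReg x (n - k)) s ∧
    s.reg t = s₀.reg x ∧ s.reg (t + 1) = k ∧ s.reg (t + 2) = 1 ∧ P (n - k) (s.reg ρ) (s.arr ρ)
    with hJ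
  have hloop := Runs.loop (x := t + 1)
    (p := .seq body (.seq (.add x x (t + 2)) (.sub (t + 1) (t + 1) (t + 2)))) (C := C + (1 + 1)) J
    (fun i s h => h.2.2.2.1) (by
      rintro k s ⟨hk, hS, ht, ht1, ht2, hP⟩
      have hi : n - (k + 1) + 1 = n - k := by omega
      refine (hbody (n - (k + 1)) (by omega) s hS hP).seq fun s' ⟨hS', hP'⟩ => ?_
      rw [hi] at hP'
      refine Runs.seq (Q := fun s'' => s'' = s'.setReg x (s'.reg x + s'.reg (t + 2)))
        (Runs.add rfl) ?_
      rintro _ rfl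
      have e1 : s'.reg (t + 1) = k + 1 := ((hS' (t + 1) (by omega) (by omega)).1).trans ht1
      have e2 : s'.reg (t + 2) = 1 := ((hS' (t + 2) (by omega) (by omega)).1).trans ht2
      have e0 : s'.reg t = s₀.reg x := ((hS' t (by omega) (by omega)).1).trans ht
      have ex : s'.reg x = n - (k + 1) := by
        rw [(hS' x (by omega) hxρ).1, (hS x hx hxρ).1]; simp
      refine Runs.sub ⟨by omega, ?_, ?_, ?_, ?_, ?_⟩
      · intro r hr hrρ
        have h1 := hS r hr hrρ
        have h2 := hS' r (by omega) hrρ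
        by_cases hrx : r = x
        · subst hrx
          simp [show r ≠ t + 1 by omega, ex, e2, hi, h1.2, h2.2]
        · simp [hrx, show r ≠ t + 1 by omega] at h1 ⊢
          exact ⟨h2.1.trans h1.1, h2.2.trans h1.2⟩
      · simp [show t ≠ x by omega, e0]
      · simp [show t + 1 ≠ x by omega, show t + 2 ≠ x by omega, e1, e2]
      · simp [show t + 2 ≠ x by omega, e2]
      · simpa [show ρ ≠ t + 1 by omega, Ne.symm hxρ] using hP')
  refine Runs.mono (C := 1 + (1 + (1 + (1 + ((n * (C + (1 + 1) + 1) + 1) + 1))))) ?_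
    (by ring_nf; omega) (fun _ h => h)
  refine Runs.seq (Q := fun s' => s' = s₀.setReg t (s₀.reg x)) (Runs.copy rfl) ?_
  rintro _ rfl
  refine Runs.seq (Q := fun s' => s' = (s₀.setReg t (s₀.reg x)).setReg x 0) (Runs.const rfl) ?_
  rintro _ rfl
  refine Runs.seq (Q := fun s' => s' = ((s₀.setReg t (s₀.reg x)).setReg x 0).setReg (t + 1) n)
    (Runs.copy (by simp [hNx, show N ≠ t by omega, hn])) ?_
  rintro _ rfl
  refine Runs.seq (Q := J n) (Runs.const ?_) fun s hs => (hloop n s hs).seq fun s' hs' => ?_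
  · refine ⟨le_rfl, ?_, ?_, ?_, ?_, ?_⟩
    · intro r hr hrρ
      by_cases hrx : r = x
      · subst hrx
        simp [show r ≠ t + 1 by omega, show r ≠ t + 2 by omega]
      · simp [hrx, show r ≠ t + 1 by omega, show r ≠ t + 2 by omega, show r ≠ t by omega]
    · simp [show t ≠ x by omega]
    · simp
    · simp
    · simpa [show ρ ≠ t + 1 by omega, Ne.symm hxρ, show ρ ≠ t + 2 by omega,
        show ρ ≠ t by omega] using h₀
  · obtain ⟨-, hS, ht, -, -, hP⟩ := hs'
    refine Runs.copy ⟨?_, by simpa [Ne.symm hxρ] using hP⟩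
    intro r hr hrρ
    have h1 := hS r hr hrρ
    by_cases hrx : r = x
    · subst hrx
      simp [ht, h1.2]
    · simpa [hrx] using h1

/-! ### Reachability in a finite directed graph -/

/-- The vertices among `0, …, n - 1` that can be reached from the set `init` by `step`s. -/
inductive Reach (n : ℕ) (init : ℕ → Prop) (step : ℕ → ℕ → Prop) : ℕ → Prop
  | base {i : ℕ} : i < n → init i → Reach n init step i
  | step {i j : ℕ} : Reach n init step i → j < n → step i j → Reach n init step j

theorem Reach.lt {n : ℕ} {init : ℕ → Prop} {step : ℕ → ℕ → Prop} {i : ℕ}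
    (h : Reach n init step i) : i < n := by
  cases h <;> assumption

/-- After `n` rounds, a growing sequence of subsets of `{0, …, n - 1}` in which every round adds
all successors contains all reachable vertices. -/
theorem Reach.mem_of_rounds {n : ℕ} {init : ℕ → Prop} {step : ℕ → ℕ → Prop}
    (S : ℕ → Set ℕ) (h₀ : ∀ i < n, init i → i ∈ S 0)
    (hmono : ∀ r, S r ⊆ S (r + 1))
    (hstep : ∀ r, ∀ i < n, ∀ j < n, i ∈ S r → step i j → j ∈ S (r + 1)) {i : ℕ}
    (hi : Reach n init step i) : i ∈ S n := by
  classical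
  have hm : Monotone S := monotone_nat_of_le_succ hmono
  -- Pigeonhole: either some round adds no number below `n`, or every round adds at least one.
  have key : ∀ r, (∃ r' ≤ r, ∀ i < n, i ∈ S (r' + 1) → i ∈ S r') ∨
      r ≤ ((Finset.range n).filter (· ∈ S r)).card := by
    intro r
    induction r with
    | zero => right; simp
    | succ r ih =>
      rcases ih with ⟨r', h1, h2⟩ | h
      · exact .inl ⟨r', by omega, h2⟩
      by_cases hc : ∀ i < n, i ∈ S (r + 1) → i ∈ S r
      · exact .inl ⟨r, by omega, hc⟩
      · right
        push Not at hc
        obtain ⟨i, hi, h1, h2⟩ := hc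
        refine Nat.succ_le_of_lt (h.trans_lt (Finset.card_lt_card ?_))
        refine (Finset.ssubset_iff_of_subset ?_).2 ⟨i, by simp [hi, h1], by simp [h2]⟩
        intro k hk
        simp only [Finset.mem_filter] at hk ⊢
        exact ⟨hk.1, hmono r hk.2⟩
  -- A round without additions shows that the set is closed under steps.
  have closed : ∀ r', (∀ i < n, i ∈ S (r' + 1) → i ∈ S r') → ∀ i, Reach n init step i →
      i ∈ S r' := by
    intro r' h i hi
    induction hi with
    | base h1 h2 => exact hm (Nat.zero_le _) (h₀ _ h1 h2)
    | step h1 h2 h3 ih => exact h _ h2 (hstep _ _ h1.lt _ h2 ih h3)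
  rcases key n with ⟨r', h1, h2⟩ | h
  · exact hm h1 (closed r' h2 i hi)
  · have : (Finset.range n).filter (· ∈ S n) = Finset.range n :=
      Finset.eq_of_subset_of_card_le (Finset.filter_subset _ _) (by simpa using h)
    have hin : i ∈ (Finset.range n).filter (· ∈ S n) := by
      rw [this]; simpa using hi.lt
    exact (Finset.mem_filter.1 hin).2

end RAM

namespace RAM

/-! ### Expressions with bounded loops and reachability -/

/-- Expressions over the memory of a random access machine. -/
inductive Expr where
  /-- a constant -/
  | const (c : ℕ)
  /-- the content of a register -/
  | reg (x : ℕ)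
  /-- sum -/
  | add (a b : Expr)
  /-- truncated difference -/
  | sub (a b : Expr)
  /-- an array cell -/
  | arr (a : ℕ) (i : Expr)
  /-- if `c ≠ 0` then `a` else `b` -/
  | ite (c a b : Expr)
  /-- `1` if `e ≠ 0` for some value of `x` that is smaller than the content of `N`, otherwise `0` -/
  | ex (x N : ℕ) (e : Expr)
  /-- start with the value of `e₀`; for `x = 0, …, N - 1`, replace the value `a` by that of `e₁` -/
  | iter (x a N : ℕ) (e₀ e₁ : Expr)
  /-- `1` if the vertex `z` is reachable in the graph on `0, …, N - 1`, in which `init` describes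
  the sources, in terms of `x`, and `step` the arcs, in terms of the tail `y` and the head `x` -/
  | reach (x y N : ℕ) (init step z : Expr)

namespace Expr

open Classical in
/-- The value of an expression. -/
noncomputable def eval : Expr → State → ℕ
  | const c, _ => c
  | reg x, s => s.reg x
  | add a b, s => a.eval s + b.eval s
  | sub a b, s => a.eval s - b.eval s
  | arr a i, s => s.arr a (i.eval s)
  | ite c a b, s => if c.eval s = 0 then b.eval s else a.eval s
  | ex x N e, s => if ∃ i < s.reg N, e.eval (s.setReg x i) ≠ 0 then 1 else 0
  | iter x a N e₀ e₁, s =>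
      Nat.rec (e₀.eval s) (fun i r => e₁.eval ((s.setReg x i).setReg a r)) (s.reg N)
  | reach x y N init step z, s =>
      if Reach (s.reg N) (fun i => init.eval (s.setReg x i) ≠ 0)
        (fun i j => step.eval ((s.setReg y i).setReg x j) ≠ 0) (z.eval s) then 1 else 0

/-- All registers and arrays in the expression are below `t`, all loops are bounded by registers
in `R`, and these are not used as loop variables. -/
def wf (R : List ℕ) (t : ℕ) : Expr → Bool
  | const _ => true
  | reg x => decide (x < t)
  | add a b => a.wf R t && b.wf R t
  | sub a b => a.wf R t && b.wf R t
  | arr a i => decide (a < t) && i.wf R t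
  | ite c a b => c.wf R t && a.wf R t && b.wf R t
  | ex x N e => decide (x < t ∧ x ∉ R ∧ N ∈ R) && e.wf R t
  | iter x a N e₀ e₁ => decide (x < t ∧ x ∉ R ∧ a < t ∧ a ∉ R ∧ x ≠ a ∧ N ∈ R) &&
      e₀.wf R t && e₁.wf R t
  | reach x y N init step z => decide (x < t ∧ x ∉ R ∧ y < t ∧ y ∉ R ∧ x ≠ y ∧ N ∈ R) &&
      init.wf R t && step.wf R t && z.wf R t

theorem wf_mono {R : List ℕ} {t t' : ℕ} (h : t ≤ t') (e : Expr) (he : e.wf R t = true) :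
    e.wf R t' = true := by
  induction e <;> simp_all [wf] <;> omega

/-- Evaluation reads only memory below `t`, loop bounds included. Thus a subexpression computed in
an intermediate state has the value prescribed by the original state. -/
theorem eval_congr {R : List ℕ} {t : ℕ} (hR : ∀ N ∈ R, N < t) (e : Expr) :
    ∀ {s s' : State}, e.wf R t = true → Same t t s s' → e.eval s' = e.eval s := by
  induction e with
  | const => intros; rfl
  | reg x =>
    intro s s' h hs
    simp only [wf, decide_eq_true_eq] at h
    exact (hs x h h.ne).1
  | add a b iha ihb | sub a b iha ihb =>
    intro s s' h hs
    simp only [wf, Bool.and_eq_true] at h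
    simp only [eval, iha h.1 hs, ihb h.2 hs]
  | arr a i ih =>
    intro s s' h hs
    simp only [wf, Bool.and_eq_true, decide_eq_true_eq] at h
    simp only [eval, ih h.2 hs, (hs a h.1 h.1.ne).2]
  | ite c a b ihc iha ihb =>
    intro s s' h hs
    simp only [wf, Bool.and_eq_true] at h
    simp only [eval, ihc h.1.1 hs, iha h.1.2 hs, ihb h.2 hs]
  | ex x N e ih =>
    intro s s' h hs
    simp only [wf, Bool.and_eq_true, decide_eq_true_eq] at h
    have hN := hR N h.1.2.2
    simp only [eval, (hs N hN hN.ne).1, ih h.2 (hs.setReg x _)]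
  | iter x a N e₀ e₁ ih₀ ih₁ =>
    intro s s' h hs
    simp only [wf, Bool.and_eq_true, decide_eq_true_eq] at h
    have hN := hR N h.1.1.2.2.2.2.2
    simp only [eval, (hs N hN hN.ne).1, ih₀ h.1.2 hs, ih₁ h.2 ((hs.setReg x _).setReg a _)]
  | reach x y N init step z ihi ihs ihz =>
    intro s s' h hs
    simp only [wf, Bool.and_eq_true, decide_eq_true_eq] at h
    have hN := hR N h.1.1.1.2.2.2.2.2
    have h₁ : ∀ i, init.eval (s'.setReg x i) = init.eval (s.setReg x i) :=
      fun i => ihi h.1.1.2 (hs.setReg x i)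
    have h₂ : ∀ i j, step.eval ((s'.setReg y i).setReg x j) =
        step.eval ((s.setReg y i).setReg x j) :=
      fun i j => ihs h.1.2 ((hs.setReg y i).setReg x j)
    classical
    have key : ∀ {n n' z z' : ℕ} {f f' : ℕ → ℕ} {g g' : ℕ → ℕ → ℕ}, n' = n → z' = z →
        (∀ i, f' i = f i) → (∀ i j, g' i j = g i j) →
        (if Reach n' (fun i => f' i ≠ 0) (fun i j => g' i j ≠ 0) z' then 1 else 0) =
          if Reach n (fun i => f i ≠ 0) (fun i j => g i j ≠ 0) z then 1 else 0 := by
      rintro n _ z _ f f' g g' rfl rfl hf hg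
      obtain rfl : f' = f := funext hf
      obtain rfl : g' = g := funext₂ hg
      rfl
    exact key (hs N hN hN.ne).1 (ihz h.2 hs) h₁ h₂

/-! ### Compilation of expressions and its cost -/

/-- A program that computes the value of an expression into register `t`, with the help of
registers and arrays from index `t` on. -/
def compile : Expr → ℕ → Prog
  | const c, t => .const t c
  | reg x, t => .copy t x
  | add a b, t => .seq (a.compile t) (.seq (b.compile (t + 1)) (.add t t (t + 1)))
  | sub a b, t => .seq (a.compile t) (.seq (b.compile (t + 1)) (.sub t t (t + 1)))
  | arr a i, t => .seq (i.compile t) (.load t a t)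
  | ite c a b, t => .seq (c.compile t) (.ite t (a.compile t) (b.compile t))
  | ex x N e, t => .seq (.const t 0) (.forTo (t + 1) x N
      (.seq (e.compile (t + 4)) (.ite (t + 4) (.const t 1) (.copy t t))))
  | iter x a N e₀ e₁, t => .seq (e₀.compile t) (.forTo (t + 1) x N
      (.seq (.copy (t + 4) a) (.seq (.copy a t) (.seq (e₁.compile (t + 5))
        (.seq (.copy t (t + 5)) (.copy a (t + 4)))))))
  | reach x y N init step z, t =>
      .seq (.forTo (t + 1) x N (.seq (init.compile (t + 4)) (.store t x (t + 4))))
      (.seq (.forTo (t + 1) x N (.forTo (t + 4) y N (.forTo (t + 7) x N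
          (.seq (.load (t + 10) t y) (.ite (t + 10)
            (.seq (step.compile (t + 10)) (.ite (t + 10) (.store t x (t + 10)) (.copy t t)))
            (.copy t t))))))
        (.seq (z.compile (t + 1)) (.seq (.sub t N (t + 1)) (.ite t
          (.seq (.load t t (t + 1)) (.ite t (.const t 1) (.const t 0))) (.copy t t)))))

open Polynomial in
/-- A bound on the running time of the compiled program in terms of a bound on the lengths of
the loops. -/
noncomputable def cost : Expr → ℕ[X]
  | const _ => 1
  | reg _ => 1
  | add a b => a.cost + (b.cost + 1)
  | sub a b => a.cost + (b.cost + 1)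
  | arr _ i => i.cost + 1
  | ite c a b => c.cost + (a.cost + b.cost + 1)
  | ex _ _ e => 1 + (X * ((e.cost + (1 + 1)) + 3) + 6)
  | iter _ _ _ e₀ e₁ => e₀.cost + (X * ((1 + (1 + (e₁.cost + (1 + 1)))) + 3) + 6)
  | reach _ _ _ init step z =>
      (X * ((init.cost + 1) + 3) + 6) +
      ((X * ((X * ((X * ((1 + ((step.cost + (1 + 1)) + 1)) + 3) + 6) + 3) + 6) + 3) + 6) +
        (z.cost + (1 + ((1 + (1 + 1)) + 1))))

/-- The compiled program computes the value of the expression. -/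
theorem runs_compile {R : List ℕ} {B : ℕ} (e : Expr) :
    ∀ {t : ℕ} {s : State}, e.wf R t = true → (∀ N ∈ R, N < t ∧ s.reg N ≤ B) →
      Runs (e.compile t) s (e.cost.eval B) fun s' => s'.reg t = e.eval s ∧ Same t t s s' := by
  induction e with
  | const c =>
    intro t s _ _
    simp only [cost, Polynomial.eval_one]
    exact Runs.const ⟨by simp [eval], (Same.refl _ _ _).setReg_right (by simp) _⟩
  | reg x =>
    intro t s _ _
    simp only [cost, Polynomial.eval_one]
    exact Runs.copy ⟨by simp [eval], (Same.refl _ _ _).setReg_right (by simp) _⟩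
  | add a b iha ihb | sub a b iha ihb =>
    intro t s h hR
    simp only [wf, Bool.and_eq_true] at h
    simp only [cost, Polynomial.eval_add, Polynomial.eval_one]
    refine (iha h.1 hR).seq fun s₁ ⟨h₁, hS₁⟩ => ?_
    have hb := ihb (wf_mono (Nat.le_succ t) b h.2) (s := s₁) fun N hN =>
      ⟨by have := (hR N hN).1; omega, by
        rw [(hS₁ N (hR N hN).1 (hR N hN).1.ne).1]; exact (hR N hN).2⟩
    refine hb.seq fun s₂ ⟨h₂, hS₂⟩ => ?_
    first | refine Runs.add ⟨?_, ?_⟩ | refine Runs.sub ⟨?_, ?_⟩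
    · simp only [State.setReg_reg, if_true, h₂, (hS₂ t (by omega) (by omega)).1, h₁, eval]
      rw [eval_congr (fun N hN => (hR N hN).1) b h.2 hS₁]
    · exact (hS₁.trans (hS₂.of_self.mono (by omega))).setReg_right (by simp) _
  | arr a i ih =>
    intro t s h hR
    simp only [wf, Bool.and_eq_true, decide_eq_true_eq] at h
    simp only [cost, Polynomial.eval_add, Polynomial.eval_one]
    refine (ih h.2 hR).seq fun s₁ ⟨h₁, hS₁⟩ => ?_
    refine Runs.load ⟨?_, hS₁.setReg_right (by simp) _⟩
    simp only [State.setReg_reg, if_true, h₁, (hS₁ a h.1 h.1.ne).2, eval]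
  | ite c a b ihc iha ihb =>
    intro t s h hR
    simp only [wf, Bool.and_eq_true] at h
    simp only [cost, Polynomial.eval_add, Polynomial.eval_one]
    refine (ihc h.1.1 hR).seq fun s₁ ⟨h₁, hS₁⟩ => ?_
    have hR₁ : ∀ N ∈ R, N < t ∧ s₁.reg N ≤ B := fun N hN =>
      ⟨(hR N hN).1, by rw [(hS₁ N (hR N hN).1 (hR N hN).1.ne).1]; exact (hR N hN).2⟩
    have hR₀ : ∀ N ∈ R, N < t := fun N hN => (hR N hN).1
    refine Runs.ite (fun hc => ?_) (fun hc => ?_)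
    · refine (iha h.1.2 hR₁).mono (by omega) fun s₂ ⟨h₂, hS₂⟩ => ⟨?_, hS₁.trans hS₂⟩
      rw [h₂, eval_congr hR₀ a h.1.2 hS₁, eval, if_neg (by rwa [← h₁])]
    · refine (ihb h.2 hR₁).mono (by omega) fun s₂ ⟨h₂, hS₂⟩ => ⟨?_, hS₁.trans hS₂⟩
      rw [h₂, eval_congr hR₀ b h.2 hS₁, eval, if_pos (by rwa [← h₁])]
  | ex x N e ih =>
    intro t s h hR
    simp only [wf, Bool.and_eq_true, decide_eq_true_eq] at h
    obtain ⟨⟨hx, hxR, hN⟩, he⟩ := h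
    have hNt := (hR N hN).1
    have hNx : N ≠ x := fun h => hxR (h ▸ hN)
    have hR₀ : ∀ N ∈ R, N < t := fun N hN => (hR N hN).1
    simp only [cost, Polynomial.eval_add, Polynomial.eval_one, Polynomial.eval_mul,
      Polynomial.eval_X, Polynomial.eval_ofNat]
    refine Runs.seq (Q := fun s' => s' = s.setReg t 0) (Runs.const rfl) ?_
    rintro _ rfl
    refine (Runs.forTo (ρ := t) (n := s.reg N) (C := e.cost.eval B + (1 + 1))
      (fun i r _ => (r = if ∃ j < i, e.eval (s.setReg x j) ≠ 0 then 1 else 0))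
      (by omega) (by omega) (by omega) (by omega) hNx (by simp [hNt.ne]) ?_ (by simp)).mono ?_ ?_
    · intro i hi s₁ hS hP
      have hS' : Same t t (s.setReg x i) s₁ := by
        intro r hr hrt
        have := hS r (by omega) hrt
        simpa [hr.ne] using this
      have hR₁ : ∀ N ∈ R, N < t + 4 ∧ s₁.reg N ≤ B := fun M hM =>
        ⟨by have := hR₀ M hM; omega, by
          rw [(hS' M (hR₀ M hM) (hR₀ M hM).ne).1]
          have : M ≠ x := fun h => hxR (h ▸ hM)
          simpa [this] using (hR M hM).2⟩
      refine (ih (wf_mono (by omega) e he) hR₁).seq fun s₂ ⟨h₂, hS₂⟩ => ?_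
      have hv : e.eval s₁ = e.eval (s.setReg x i) := eval_congr hR₀ e he hS'
      have key : (∃ j < i + 1, e.eval (s.setReg x j) ≠ 0) ↔
          (∃ j < i, e.eval (s.setReg x j) ≠ 0) ∨ e.eval (s.setReg x i) ≠ 0 := by
        simp only [Nat.lt_succ_iff_lt_or_eq]
        constructor
        · rintro ⟨j, hj | rfl, h⟩
          exacts [.inl ⟨j, hj, h⟩, .inr h]
        · rintro (⟨j, hj, h⟩ | h)
          exacts [⟨j, .inl hj, h⟩, ⟨i, .inr rfl, h⟩]
      refine Runs.ite (fun hc => Runs.const ⟨?_, ?_⟩) (fun hc => Runs.copy ⟨?_, ?_⟩)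
      · exact (hS₂.of_self.mono (by omega)).setReg_right (by simp) _
      · rw [h₂, hv] at hc
        simp only [State.setReg_reg, if_true, key, hc, ne_eq, not_false_eq_true, or_true]
      · exact (hS₂.of_self.mono (by omega)).setReg_right (by simp) _
      · rw [h₂, hv] at hc
        simp only [State.setReg_reg, if_true, key, hc, ne_eq, not_true_eq_false, or_false]
        rw [(hS₂ t (by omega) (by omega)).1]
        exact hP
    · have := Nat.mul_le_mul_right (e.cost.eval B + (1 + 1) + 3) (hR N hN).2
      omega
    · rintro s' ⟨hS, hP⟩
      refine ⟨by rw [hP]; simp only [eval], ?_⟩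
      intro r hr hrt
      simpa [hr.ne] using hS r (by omega) hrt
  | iter x a N e₀ e₁ ih₀ ih₁ =>
    intro t s h hR
    simp only [wf, Bool.and_eq_true, decide_eq_true_eq] at h
    obtain ⟨⟨⟨hx, hxR, ha, haR, hxa, hN⟩, he₀⟩, he₁⟩ := h
    have hNt := (hR N hN).1
    have hNx : N ≠ x := fun h => hxR (h ▸ hN)
    have hR₀ : ∀ N ∈ R, N < t := fun N hN => (hR N hN).1
    simp only [cost, Polynomial.eval_add, Polynomial.eval_one, Polynomial.eval_mul,
      Polynomial.eval_X, Polynomial.eval_ofNat]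
    refine (ih₀ he₀ hR).seq fun s₁ ⟨h₁, hS₁⟩ => ?_
    have hsN : s₁.reg N = s.reg N := (hS₁ N hNt hNt.ne).1
    refine (Runs.forTo (ρ := t) (n := s.reg N) (C := 1 + (1 + (e₁.cost.eval B + (1 + 1))))
      (fun i r _ => (r = Nat.rec (e₀.eval s)
        (fun i r => e₁.eval ((s.setReg x i).setReg a r)) i))
      (by omega) (by omega) (by omega) (by omega) hNx hsN ?_ (by simp [h₁])).mono ?_ ?_
    · intro i hi s₂ hS hP
      have hS' : Same t t (s.setReg x i) s₂ :=
        (hS₁.setReg x i).trans (hS.mono (by omega))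
      -- Register `a` lies below `t` and must survive, so it is saved in `t + 4` while it carries
      -- the accumulated value.
      refine Runs.seq (Q := fun s' => s' = s₂.setReg (t + 4) (s₂.reg a)) (Runs.copy rfl) ?_
      rintro _ rfl
      refine Runs.seq (Q := fun s' => s' = (s₂.setReg (t + 4) (s₂.reg a)).setReg a (s₂.reg t))
        (Runs.copy (by simp)) ?_
      rintro _ rfl
      have hS'' : Same t t ((s.setReg x i).setReg a (s₂.reg t))
          ((s₂.setReg (t + 4) (s₂.reg a)).setReg a (s₂.reg t)) :=
        (hS'.setReg_right (by omega) _).setReg _ _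
      have hR₁ : ∀ M ∈ R, M < t + 5 ∧
          ((s₂.setReg (t + 4) (s₂.reg a)).setReg a (s₂.reg t)).reg M ≤ B := fun M hM =>
        ⟨by have := hR₀ M hM; omega, by
          rw [(hS'' M (hR₀ M hM) (hR₀ M hM).ne).1]
          have h1 : M ≠ x := fun h => hxR (h ▸ hM)
          have h2 : M ≠ a := fun h => haR (h ▸ hM)
          simpa [h1, h2] using (hR M hM).2⟩
      refine (ih₁ (wf_mono (by omega) e₁ he₁) hR₁).seq fun s₃ ⟨h₃, hS₃⟩ => ?_
      refine Runs.seq (Q := fun s' => s' = s₃.setReg t (s₃.reg (t + 5))) (Runs.copy rfl) ?_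
      rintro _ rfl
      refine Runs.copy ⟨?_, ?_⟩
      · intro r hr hrt
        have h1 := hS₃ r (by omega) (by omega)
        have h2 := hS₃ (t + 4) (by omega) (by omega)
        by_cases hra : r = a
        · subst hra
          simp at h1 h2
          simp [h2, h1, show t + 4 ≠ r by omega]
        · simp [hra, show r ≠ t + 4 by omega] at h1
          simp [hra, hrt, h1]
      · simp only [State.setReg_reg, if_true, show t ≠ a by omega, if_false, h₃]
        rw [eval_congr hR₀ e₁ he₁ hS'', hP]
    · have := Nat.mul_le_mul_right (1 + (1 + (e₁.cost.eval B + (1 + 1))) + 3) (hR N hN).2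
      omega
    · rintro s' ⟨hS, hP⟩
      exact ⟨by rw [hP]; simp only [eval], hS₁.trans (hS.mono (by omega))⟩
  | reach x y N init step z ihi ihs ihz =>
    intro t s h hR
    simp only [wf, Bool.and_eq_true, decide_eq_true_eq] at h
    obtain ⟨⟨⟨⟨hx, hxR, hy, hyR, hxy, hN⟩, hei⟩, hes⟩, hez⟩ := h
    have hNt := (hR N hN).1
    have hNx : N ≠ x := fun h => hxR (h ▸ hN)
    have hNy : N ≠ y := fun h => hyR (h ▸ hN)
    have hR₀ : ∀ N ∈ R, N < t := fun N hN => (hR N hN).1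
    have hB := (hR N hN).2
    simp only [cost, Polynomial.eval_add, Polynomial.eval_one, Polynomial.eval_mul,
      Polynomial.eval_X, Polynomial.eval_ofNat]
    set n := s.reg N with hn
    set I : ℕ → Prop := fun i => init.eval (s.setReg x i) ≠ 0 with hI
    set T : ℕ → ℕ → Prop := fun i j => step.eval ((s.setReg y i).setReg x j) ≠ 0 with hT
    refine Runs.seq (Q := fun s' => Same t t s s' ∧ ∀ i < n, s'.arr t i ≠ 0 ↔ I i) ?_ ?_
    · refine (Runs.forTo (ρ := t) (n := n) (C := init.cost.eval B + 1)
        (fun i _ a => ∀ j < i, a j ≠ 0 ↔ I j)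
        (by omega) (by omega) (by omega) (by omega) hNx hn.symm ?_ (by simp)).mono ?_ ?_
      · intro i hi s₁ hS hP
        have hS' : Same t t (s.setReg x i) s₁ := hS.mono (by omega)
        have hR₁ : ∀ M ∈ R, M < t + 4 ∧ s₁.reg M ≤ B := fun M hM =>
          ⟨by have := hR₀ M hM; omega, by
            rw [(hS' M (hR₀ M hM) (hR₀ M hM).ne).1]
            have : M ≠ x := fun h => hxR (h ▸ hM)
            simpa [this] using (hR M hM).2⟩
        refine (ihi (wf_mono (by omega) init hei) hR₁).seq fun s₂ ⟨h₂, hS₂⟩ => ?_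
        have hv := eval_congr hR₀ init hei hS'
        have hxi : s₂.reg x = i := by
          rw [(hS₂ x (by omega) (by omega)).1, (hS' x hx hx.ne).1]; simp
        refine Runs.store ⟨(hS₂.of_self.mono (by omega)).setArr_right _ _, ?_⟩
        intro j hj
        simp only [State.setArr_arr, if_true, hxi, h₂, hv, Function.update_apply]
        rcases eq_or_ne j i with rfl | hji
        · simp [hI]
        · simp only [hji, if_false]
          rw [(hS₂ t (by omega) (by omega)).2]
          exact hP j (by omega)
      · have := Nat.mul_le_mul_right (init.cost.eval B + 1 + 3) hB
        omega
      · rintro s' ⟨hS, hP⟩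
        exact ⟨hS.mono (by omega), hP⟩
    rintro s₁ ⟨hS₁, hI₁⟩
    refine Runs.seq (Q := fun s' => Same t t s s' ∧ ∀ i < n, s'.arr t i ≠ 0 ↔ Reach n I T i) ?_ ?_
    -- `S r` is the result of `r` simultaneous rounds. Marking in place may run ahead of it, so the
    -- invariant only says that the marks contain `S r` and are reachable.
    · let S : ℕ → Set ℕ := fun r => Nat.rec {i | i < n ∧ I i}
        (fun _ A => A ∪ {j | j < n ∧ ∃ i < n, i ∈ A ∧ T i j}) r
      have hSn : ∀ i, Reach n I T i → i ∈ S n := fun i hi =>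
        Reach.mem_of_rounds S (fun i h1 h2 => ⟨h1, h2⟩) (fun r i hi => Or.inl hi)
          (fun r i hi j hj h1 h2 => Or.inr ⟨hj, i, hi, h1, h2⟩) hi
      set snd : (ℕ → ℕ) → Prop := fun a => ∀ i < n, a i ≠ 0 → Reach n I T i with hsnd
      have hN₁ : s₁.reg N = n := (hS₁ N hNt hNt.ne).1
      -- The outer loop merely counts rounds in `x`; the innermost loop reuses `x` for the head of
      -- an arc and restores it.
      refine (Runs.forTo (ρ := t) (n := n)
        (C := n * ((n * ((1 + ((step.cost.eval B + (1 + 1)) + 1)) + 3) + 6) + 3) + 6)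
        (fun r _ a => snd a ∧ ∀ i ∈ S r, a i ≠ 0)
        (by omega) (by omega) (by omega) (by omega) hNx hN₁ ?_ ?_).mono ?_ ?_
      · intro r hr s₂ hS₂ hP₂
        have hN₂ : s₂.reg N = n := by
          rw [(hS₂ N (by omega) hNt.ne).1]; simpa [hNx] using hN₁
        have hS₂' : Same t t (s.setReg x r) s₂ := (hS₁.setReg x r).trans (hS₂.mono (by omega))
        refine (Runs.forTo (ρ := t) (t := t + 4) (n := n)
          (C := n * ((1 + ((step.cost.eval B + (1 + 1)) + 1)) + 3) + 6)
          (fun k _ a => snd a ∧ (∀ i ∈ S r, a i ≠ 0) ∧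
            ∀ i < k, i ∈ S r → ∀ j < n, T i j → a j ≠ 0)
          (by omega) (by omega) (by omega) (by omega) hNy hN₂ ?_ ?_).mono le_rfl ?_
        · intro k hk s₃ hS₃ hP₃
          have hN₃ : s₃.reg N = n := by
            rw [(hS₃ N (by omega) hNt.ne).1]; simpa [hNy] using hN₂
          refine (Runs.forTo (ρ := t) (t := t + 7) (n := n)
            (C := (1 + ((step.cost.eval B + (1 + 1)) + 1)))
            (fun l _ a => snd a ∧ (∀ i ∈ S r, a i ≠ 0) ∧
              (∀ i < k, i ∈ S r → ∀ j < n, T i j → a j ≠ 0) ∧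
              (k ∈ S r → ∀ j < l, T k j → a j ≠ 0))
            (by omega) (by omega) (by omega) (by omega) hNx hN₃ ?_ ?_).mono le_rfl ?_
          · intro l hl s₄ hS₄ ⟨hP1, hP2, hP3, hP4⟩
            have hy₄ : s₄.reg y = k := by
              rw [(hS₄ y (by omega) (by omega)).1]
              simp only [State.setReg_reg, Ne.symm hxy, if_false]
              rw [(hS₃ y (by omega) (by omega)).1]; simp
            have hx₄ : s₄.reg x = l := by
              rw [(hS₄ x (by omega) (by omega)).1]; simp
            have hS₄' : Same t t ((s.setReg y k).setReg x l) s₄ := by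
              intro q hq hqt
              have h1 := hS₂' q hq hqt
              have h2 := hS₃ q (by omega) hqt
              have h3 := hS₄ q (by omega) hqt
              by_cases hqx : q = x
              · subst hqx
                simp_all
              · by_cases hqy : q = y
                · subst hqy
                  simp_all
                · simp_all
            refine Runs.seq (Q := fun s' => s' = s₄.setReg (t + 10) (s₄.arr t k))
              (Runs.load (by rw [hy₄])) ?_
            rintro _ rfl
            have hS₅ : Same t t ((s.setReg y k).setReg x l)
                (s₄.setReg (t + 10) (s₄.arr t k)) := hS₄'.setReg_right (by omega) _
            refine Runs.ite (fun hc => ?_) (fun hc => ?_)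
            · have hR₁ : ∀ M ∈ R, M < t + 10 ∧
                  (s₄.setReg (t + 10) (s₄.arr t k)).reg M ≤ B := fun M hM =>
                ⟨by have := hR₀ M hM; omega, by
                  rw [(hS₅ M (hR₀ M hM) (hR₀ M hM).ne).1]
                  have h1 : M ≠ x := fun h => hxR (h ▸ hM)
                  have h2 : M ≠ y := fun h => hyR (h ▸ hM)
                  simpa [h1, h2] using (hR M hM).2⟩
              refine (ihs (wf_mono (by omega) step hes) hR₁).seq fun s₆ ⟨h₆, hS₆⟩ => ?_
              have hv : step.eval (s₄.setReg (t + 10) (s₄.arr t k)) =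
                step.eval ((s.setReg y k).setReg x l) := eval_congr hR₀ step hes hS₅
              have hS₇ : Same t (t + 10) s₄ s₆ :=
                ((Same.refl t (t + 10) s₄).setReg_right (by omega) _).trans hS₆.of_self
              have hx₆ : s₆.reg x = l := ((hS₇ x (by omega) (by omega)).1).trans hx₄
              have ha₆ : s₆.arr t = s₄.arr t := by
                simpa using (hS₆ t (by omega) (by omega)).2
              simp only [State.setReg_reg, if_true] at hc
              refine Runs.ite (fun hc' => ?_) (fun hc' => ?_)
              · refine Runs.store ⟨hS₇.setArr_right _ _, ?_⟩
                rw [h₆, hv] at hc'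
                have hrl : Reach n I T l := .step (hP1 k hk hc) hl hc'
                simp only [State.setArr_arr, if_true, hx₆, h₆, hv, ha₆]
                -- The stored value is nonzero, so no mark is erased.
                have hge : ∀ j, s₄.arr t j ≠ 0 → Function.update (s₄.arr t) l
                    (step.eval ((s.setReg y k).setReg x l)) j ≠ 0 := by
                  intro j hj
                  rcases eq_or_ne j l with rfl | h
                  · simpa using hc'
                  · simpa [h] using hj
                refine ⟨?_, fun i hi => hge i (hP2 i hi),
                  fun i hi hiS j hj hT => hge j (hP3 i hi hiS j hj hT), ?_⟩
                · intro j hj hja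
                  rcases eq_or_ne j l with rfl | h
                  · exact hrl
                  · rw [Function.update_of_ne h] at hja
                    exact hP1 j hj hja
                · intro hkS j hj hT
                  rcases eq_or_ne j l with rfl | h
                  · simpa using hc'
                  · exact hge j (hP4 hkS j (by omega) hT)
              · refine Runs.copy ⟨hS₇.setReg_right (by simp) _, ?_⟩
                rw [h₆, hv] at hc'
                simp only [State.setReg_arr, ha₆]
                refine ⟨hP1, hP2, hP3, ?_⟩
                intro hkS j hj hT
                rcases eq_or_ne j l with rfl | h
                · exact absurd hc' hT
                · exact hP4 hkS j (by omega) hT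
            · refine Runs.mono (C := 1) (Runs.copy ⟨?_, ?_⟩) (by omega) fun _ h => h
              · exact ((Same.refl t (t + 10) s₄).setReg_right (by omega) _).setReg_right (by simp) _
              · simp only [State.setReg_reg, if_true] at hc
                simp only [State.setReg_arr]
                exact ⟨hP1, hP2, hP3, fun hkS => absurd hc (hP2 k hkS)⟩
          · exact ⟨hP₃.1, hP₃.2.1, hP₃.2.2, by simp⟩
          · rintro s' ⟨hS', h1, h2, h3, h4⟩
            refine ⟨hS', h1, h2, fun i hi hiS j hj hT => ?_⟩
            rcases Nat.lt_succ_iff_lt_or_eq.1 hi with h | rfl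
            · exact h3 i h hiS j hj hT
            · exact h4 hiS j hj hT
        · exact ⟨hP₂.1, hP₂.2, by simp⟩
        · rintro s' ⟨hS', h1, h2, h3⟩
          refine ⟨hS', h1, ?_⟩
          rintro j (hj | ⟨hj, i, hi, hiS, hT⟩)
          · exact h2 j hj
          · exact h3 i hi hiS j hj hT
      · exact ⟨fun i hi h => .base hi ((hI₁ i hi).1 h), fun i hi => (hI₁ i hi.1).2 hi.2⟩
      · gcongr
      · rintro s' ⟨hS', h1, h2⟩
        exact ⟨hS₁.trans (hS'.mono (by omega)), fun i hi => ⟨h1 i hi, fun h => h2 i (hSn i h)⟩⟩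
    rintro s₂ ⟨hS₂, hA⟩
    have hN₂ : s₂.reg N = n := (hS₂ N hNt hNt.ne).1
    have hR₂ : ∀ M ∈ R, M < t + 1 ∧ s₂.reg M ≤ B := fun M hM =>
      ⟨by have := hR₀ M hM; omega, by
        rw [(hS₂ M (hR₀ M hM) (hR₀ M hM).ne).1]; exact (hR M hM).2⟩
    refine (ihz (wf_mono (by omega) z hez) hR₂).seq fun s₃ ⟨h₃, hS₃⟩ => ?_
    rw [eval_congr hR₀ z hez hS₂] at h₃
    have hN₃ : s₃.reg N = n := by rw [(hS₃ N (by omega) (by omega)).1, hN₂]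
    have hS₃' : Same t t s s₃ := hS₂.trans (hS₃.of_self.mono (by omega))
    have ha₃ : s₃.arr t = s₂.arr t := (hS₃ t (by omega) (by omega)).2
    -- Nothing is known about the cells from `n` on, so the lookup is guarded by the test that `z`
    -- is below `n`.
    refine Runs.seq (Q := fun s' => s' = s₃.setReg t (n - z.eval s))
      (Runs.sub (by rw [hN₃, h₃])) ?_
    rintro _ rfl
    refine Runs.ite (fun hc => ?_) (fun hc => ?_)
    · simp only [State.setReg_reg, if_true] at hc
      refine Runs.seq (Q := fun s' => s' = (s₃.setReg t (n - z.eval s)).setReg t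
        (s₂.arr t (z.eval s))) (Runs.load (by simp [h₃, ha₃])) ?_
      rintro _ rfl
      have := hA (z.eval s) (by omega)
      refine Runs.ite (fun hc' => Runs.const ⟨?_, ?_⟩) (fun hc' => Runs.const ⟨?_, ?_⟩)
      · simp only [State.setReg_reg, if_true] at hc'
        simp only [State.setReg_reg, if_true, eval]
        rw [if_pos (this.1 hc')]
      · exact ((hS₃'.setReg_right (by simp) _).setReg_right (by simp) _).setReg_right (by simp) _
      · simp only [State.setReg_reg, if_true] at hc'
        simp only [State.setReg_reg, if_true, eval]
        rw [if_neg (fun h => (this.2 h) hc')]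
      · exact ((hS₃'.setReg_right (by simp) _).setReg_right (by simp) _).setReg_right (by simp) _
    · simp only [State.setReg_reg, if_true] at hc
      refine Runs.mono (C := 1) (Runs.copy ⟨?_, ?_⟩) (by omega) fun _ h => h
      · simp only [State.setReg_reg, if_true, eval, hc]
        rw [if_neg (fun h => by have := h.lt; omega)]
      · exact (hS₃'.setReg_right (by simp) _).setReg_right (by simp) _

end Expr

end RAM

/-! ### Systems of binary clauses and their solution graphs -/

/-- A set of literals with negation, together with a symmetric relation `conf`: literals `a`, `b`
with `conf a b` must not both be true. -/
structure ClauseSystem (α : Type) where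
  /-- negation of literals -/
  neg : α → α
  neg_neg : ∀ a, neg (neg a) = a
  neg_ne : ∀ a, neg a ≠ a
  /-- the binary clauses: not both `a` and `b` -/
  conf : α → α → Prop
  conf_symm : ∀ a b, conf a b → conf b a

namespace ClauseSystem

open Relation

variable {α : Type} (S : ClauseSystem α)

/-- If `a` is true then so is `b`. -/
def Imp (a b : α) : Prop := S.conf a (S.neg b)

/-- A solution, given as the set of true literals. -/
structure IsSol (σ : Set α) : Prop where
  neg_mem : ∀ d, S.neg d ∈ σ ↔ d ∉ σ
  not_conf : ∀ a ∈ σ, ∀ b ∈ σ, ¬ S.conf a b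

/-- The literals that follow from those in `W` by unit propagation. -/
def Forced (W : Set α) (d : α) : Prop := ∃ w ∈ W, ReflTransGen S.Imp w d

/-- Unit propagation from `W` does not lead to a contradiction. -/
def Consistent (W : Set α) : Prop := ∀ d, ¬ (S.Forced W d ∧ S.Forced W (S.neg d))

/-- The literal lies on a cycle of implications with at least two literals. -/
def Rigid (d : α) : Prop := ∃ d' ≠ d, ReflTransGen S.Imp d d' ∧ ReflTransGen S.Imp d' d

/-- Change the value of the true literal `d`. -/
def flip (σ : Set α) (d : α) : Set α := insert (S.neg d) (σ \ {d})

variable {S} {σ τ W : Set α} {a b d : α}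

theorem IsSol.mem_of_imp (h : S.IsSol σ) (ha : a ∈ σ) (hab : S.Imp a b) : b ∈ σ := by
  by_contra hb
  exact h.not_conf a ha _ ((h.neg_mem b).2 hb) hab

theorem IsSol.mem_of_imps (h : S.IsSol σ) (ha : a ∈ σ) (hab : ReflTransGen S.Imp a b) :
    b ∈ σ := by
  induction hab with
  | refl => exact ha
  | tail _ h' ih => exact h.mem_of_imp ih h'

theorem IsSol.consistent (h : S.IsSol σ) (hW : W ⊆ σ) : S.Consistent W := by
  rintro d ⟨⟨w, hw, h₁⟩, ⟨w', hw', h₂⟩⟩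
  exact (h.neg_mem d).1 (h.mem_of_imps (hW hw') h₂) (h.mem_of_imps (hW hw) h₁)

theorem Forced.imp (h : S.Forced W a) (hab : S.Imp a b) : S.Forced W b := by
  obtain ⟨w, hw, h⟩ := h
  exact ⟨w, hw, h.tail hab⟩

/-- If the system has a solution, then a consistent set of literals extends to a solution. -/
theorem Consistent.exists_isSol (hW : S.Consistent W) (hσ : S.IsSol σ) :
    ∃ τ, S.IsSol τ ∧ W ⊆ τ := by
  -- Forced literals take precedence, the others keep their value in `σ`. A violated clause with a
  -- forced literal would force the negation of its other literal.
  refine ⟨{d | S.Forced W d ∨ (¬ S.Forced W (S.neg d) ∧ d ∈ σ)}, ⟨fun d => ?_, ?_⟩,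
    fun d hd => .inl ⟨d, hd, .refl⟩⟩
  · have h₁ := hW d
    have h₂ := hσ.neg_mem d
    simp only [Set.mem_ofPred_eq, S.neg_neg]
    tauto
  · have key : ∀ a b, S.Forced W a → (S.Forced W b ∨ (¬ S.Forced W (S.neg b) ∧ b ∈ σ)) →
        ¬ S.conf a b := by
      intro a b ha hb hab
      have : S.Forced W (S.neg b) := ha.imp (by rw [Imp, S.neg_neg]; exact hab)
      have := hW b
      tauto
    rintro a (ha | ha) b hb hab
    · exact key a b ha hb hab
    · rcases hb with hb | hb
      · exact key b a hb (.inr ha) (S.conf_symm _ _ hab)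
      · exact hσ.not_conf a ha.2 b hb.2 hab

theorem Imp.neg (h : S.Imp a b) : S.Imp (S.neg b) (S.neg a) := by
  rw [Imp, S.neg_neg]
  exact S.conf_symm _ _ h

theorem neg_imps (h : ReflTransGen S.Imp a b) : ReflTransGen S.Imp (S.neg b) (S.neg a) := by
  induction h with
  | refl => exact .refl
  | tail _ h ih => exact ih.head h.neg

theorem Rigid.neg (h : S.Rigid d) : S.Rigid (S.neg d) := by
  obtain ⟨d', hne, h₁, h₂⟩ := h
  refine ⟨S.neg d', fun h => hne ?_, neg_imps h₂, neg_imps h₁⟩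
  rw [← S.neg_neg d', h, S.neg_neg]

theorem mem_flip : a ∈ S.flip σ d ↔ a = S.neg d ∨ (a ∈ σ ∧ a ≠ d) := by
  simp [flip]

/-- The value of a rigid literal cannot be changed alone. -/
theorem Rigid.mem_flip (ha : S.Rigid a) (hσ : S.IsSol σ) (hd : d ∈ σ)
    (hτ : S.IsSol (S.flip σ d)) (haσ : a ∈ σ) : a ∈ S.flip σ d := by
  rw [ClauseSystem.mem_flip]
  refine .inr ⟨haσ, ?_⟩
  rintro rfl
  obtain ⟨d', hne, h₁, h₂⟩ := ha
  -- The other literal of the cycle stays true and implies the one just made false.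
  have h₃ : d' ∈ S.flip σ a := ClauseSystem.mem_flip.2 (.inr ⟨hσ.mem_of_imps haσ h₁, hne⟩)
  have h₄ := hτ.mem_of_imps h₃ h₂
  rcases ClauseSystem.mem_flip.1 h₄ with h | h
  · exact S.neg_ne _ h.symm
  · exact h.2 rfl

theorem IsSol.eq_of_subset (hσ : S.IsSol σ) (hτ : S.IsSol τ) (h : σ ⊆ τ) : σ = τ := by
  refine h.antisymm fun d hd => ?_
  by_contra hdσ
  exact (hτ.neg_mem d).1 (h ((hσ.neg_mem d).2 hdσ)) hd

/-- Two different solutions that agree on rigid literals: some literal of the second can be made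
true in the first. -/
theorem IsSol.exists_flip [Finite α] (hσ : S.IsSol σ) (hτ : S.IsSol τ)
    (hr : ∀ d ∈ σ, S.Rigid d → d ∈ τ) (hne : σ ≠ τ) :
    ∃ d ∈ σ, d ∉ τ ∧ S.IsSol (S.flip σ d) := by
  have hL : (τ \ σ).Nonempty := by
    rw [Set.nonempty_iff_ne_empty, Ne, Set.sdiff_eq_empty]
    exact fun h => hne (hτ.eq_of_subset hσ h).symm
  -- For a maximal `b`, every literal of `τ \ σ` implied by `b` implies `b` in turn; as `b` is not
  -- rigid, it is `b` itself.
  let P : Preorder α :=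
    { le := fun a b => ReflTransGen S.Imp a b
      le_refl := fun _ => .refl
      le_trans := fun _ _ _ h h' => h.trans h' }
  obtain ⟨b, ⟨hbτ, hbσ⟩, hmax⟩ := (Set.toFinite (τ \ σ)).exists_maximal hL
  have hnr : ¬ S.Rigid b := fun h =>
    (hτ.neg_mem b).1 (hr _ ((hσ.neg_mem b).2 hbσ) h.neg) hbτ
  have hsink : ∀ a ∈ τ \ σ, S.Imp b a → a = b := by
    intro a ha hba
    by_contra hab
    exact hnr ⟨a, hab, .single hba, hmax ha (ReflTransGen.single hba)⟩
  refine ⟨S.neg b, (hσ.neg_mem b).2 hbσ, fun h => (hτ.neg_mem b).1 h hbτ, ?_⟩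
  -- If `b` excluded a literal `a` kept from `σ`, then `S.neg a` would be implied by `b` and lie in
  -- `τ \ σ`, hence equal `b`; but `S.neg b` is no longer true.
  have key : ∀ a ∈ S.flip σ (S.neg b), ¬ S.conf b a := by
    intro a ha hc
    rw [ClauseSystem.mem_flip, S.neg_neg] at ha
    have h₁ : S.Imp b (S.neg a) := by rw [Imp, S.neg_neg]; exact hc
    rcases ha with rfl | ⟨ha, hab⟩
    · exact hτ.not_conf _ hbτ _ hbτ hc
    · have h₂ : S.neg a ∉ σ := fun h => (hσ.neg_mem a).1 h ha
      have := hsink _ ⟨hτ.mem_of_imp hbτ h₁, h₂⟩ h₁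
      exact hab (by rw [← this, S.neg_neg])
  refine ⟨fun d => ?_, ?_⟩
  · simp only [ClauseSystem.mem_flip, S.neg_neg, hσ.neg_mem]
    have h₁ : S.neg d = b ↔ d = S.neg b :=
      ⟨fun h => by rw [← h, S.neg_neg], fun h => by rw [h, S.neg_neg]⟩
    have h₂ : S.neg d = S.neg b ↔ d = b :=
      ⟨fun h => by rw [← S.neg_neg d, h, S.neg_neg], fun h => by rw [h]⟩
    have h₃ : d = b → d ≠ S.neg b := by rintro rfl h; exact S.neg_ne _ h.symm
    have h₄ : d = b → d ∉ σ := by rintro rfl; exact hbσ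
    simp only [Ne, h₁, h₂]
    tauto
  · intro a ha c hc hac
    have ha' := ha
    have hc' := hc
    rw [ClauseSystem.mem_flip, S.neg_neg] at ha hc
    rcases ha with rfl | ha
    · exact key c hc' hac
    rcases hc with rfl | hc
    · exact key a ha' (S.conf_symm _ _ hac)
    · exact hσ.not_conf a ha.1 c hc.1 hac

/-- Two solutions that agree on rigid literals are connected by changing one value at a time,
while the common true literals remain true. -/
theorem IsSol.connected [Finite α] (hτ : S.IsSol τ) {U : Set α} (hUτ : U ⊆ τ) :
    ∀ {σ : Set α}, S.IsSol σ → U ⊆ σ → (∀ d ∈ σ, S.Rigid d → d ∈ τ) →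
      ReflTransGen (fun σ σ' => S.IsSol σ' ∧ U ⊆ σ' ∧ ∃ d ∈ σ, σ' = S.flip σ d) σ τ := by
  -- Induction on the number of literals in `σ \ τ`; each flip removes one of them.
  suffices ∀ n, ∀ {σ : Set α}, (σ \ τ).ncard = n → S.IsSol σ → U ⊆ σ →
      (∀ d ∈ σ, S.Rigid d → d ∈ τ) →
      ReflTransGen (fun σ σ' => S.IsSol σ' ∧ U ⊆ σ' ∧ ∃ d ∈ σ, σ' = S.flip σ d) σ τ from
    fun {_} hσ hU hr => this _ rfl hσ hU hr
  intro n
  induction n with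
  | zero =>
    intro σ hn hσ _ _
    rw [Set.ncard_eq_zero, Set.sdiff_eq_empty] at hn
    rw [hσ.eq_of_subset hτ hn]
  | succ n ih =>
    intro σ hn hσ hU hr
    have hne : σ ≠ τ := by rintro rfl; simp at hn
    obtain ⟨d, hd, hdτ, hs⟩ := hσ.exists_flip hτ hr hne
    have hneg : S.neg d ∈ τ := (hτ.neg_mem d).2 hdτ
    have hUf : U ⊆ S.flip σ d := fun a ha =>
      mem_flip.2 (.inr ⟨hU ha, by rintro rfl; exact hdτ (hUτ ha)⟩)
    refine .head ⟨hs, hUf, d, hd, rfl⟩ (ih ?_ hs hUf ?_)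
    · have : S.flip σ d \ τ = (σ \ τ) \ {d} := by
        ext a
        simp only [Set.mem_sdiff, mem_flip, Set.mem_singleton_iff]
        constructor
        · rintro ⟨rfl | h, h'⟩
          exacts [absurd hneg h', ⟨⟨h.1, h'⟩, h.2⟩]
        · rintro ⟨⟨h, h'⟩, h''⟩
          exact ⟨.inr ⟨h, h''⟩, h'⟩
      rw [this, Set.ncard_sdiff_singleton_of_mem (show d ∈ σ \ τ from ⟨hd, hdτ⟩), hn]
      rfl
    · intro a ha hra
      rcases mem_flip.1 ha with rfl | h
      exacts [hneg, hr a h.1 hra]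

end ClauseSystem

/-! ### Feasible orientations as solutions of clause systems -/

namespace ConstraintGraph

open Relation

variable {G : ConstraintGraph}

theorem incidence_eq (A : G.Orientation) (e : Fin G.m) (v : Fin G.n) :
    G.incidence e v = (if (A.arc e).2 = v then 1 else 0) + (if (A.arc e).1 = v then 1 else 0) := by
  unfold incidence
  rw [← A.ends_arc e]
  simp only [Sym2.mem_iff, Sym2.eq_iff]
  by_cases h₁ : (A.arc e).1 = v <;> by_cases h₂ : (A.arc e).2 = v <;>
    simp [h₁, h₂, @eq_comm _ v (A.arc e).1, @eq_comm _ v (A.arc e).2]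

namespace Orientation

/-- The number of edges of weight `w` that enter `v`. -/
def inDegree (A : G.Orientation) (w : ℕ) (v : Fin G.n) : ℕ :=
  ∑ e : Fin G.m, if G.weight e = w ∧ (A.arc e).2 = v then 1 else 0

/-- The number of edges of weight `w` that leave `v`. -/
def outDegree (A : G.Orientation) (w : ℕ) (v : Fin G.n) : ℕ :=
  ∑ e : Fin G.m, if G.weight e = w ∧ (A.arc e).1 = v then 1 else 0

variable (A : G.Orientation) (v : Fin G.n)

theorem inDegree_add_outDegree (w : ℕ) :
    A.inDegree w v + A.outDegree w v = G.degreeOfWeight w v := by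
  unfold inDegree outDegree degreeOfWeight
  rw [← Finset.sum_add_distrib]
  refine Finset.sum_congr rfl fun e _ => ?_
  rw [incidence_eq A]
  by_cases h : G.weight e = w <;> simp [h]

theorem inWeight_eq : A.inWeight v = A.inDegree 1 v + 2 * A.inDegree 2 v := by
  unfold inWeight inDegree
  rw [Finset.mul_sum, ← Finset.sum_add_distrib]
  refine Finset.sum_congr rfl fun e _ => ?_
  rcases G.weight_eq e with h | h <;> by_cases h' : (A.arc e).2 = v <;> simp [h, h']

theorem inDegree_ne_zero {w : ℕ} :
    A.inDegree w v ≠ 0 ↔ ∃ e, G.weight e = w ∧ (A.arc e).2 = v := by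
  simp [inDegree]

theorem outDegree_ne_zero {w : ℕ} :
    A.outDegree w v ≠ 0 ↔ ∃ e, G.weight e = w ∧ (A.arc e).1 = v := by
  simp [outDegree]

/-- Feasibility in AND/OR graphs: a red and a blue edge never leave the same vertex, and a blue
edge enters each OR vertex. -/
theorem feasible_iff (hG : G.IsAndOr) : A.Feasible ↔
    (∀ e e', G.weight e = 1 → G.weight e' = 2 → (A.arc e).1 ≠ (A.arc e').1) ∧
    ∀ v, G.IsOrVertex v → ∃ e, G.weight e = 2 ∧ (A.arc e).2 = v := by
  constructor
  · intro h
    refine ⟨fun e e' he he' hee' => ?_, fun v hv => ?_⟩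
    · have h₁ := (A.outDegree_ne_zero (A.arc e').1).2 ⟨e, he, hee'⟩
      have h₂ := (A.outDegree_ne_zero (A.arc e').1).2 ⟨e', he', rfl⟩
      have h₃ := h (A.arc e').1
      rw [inWeight_eq] at h₃
      have h₄ := A.inDegree_add_outDegree (A.arc e').1 1
      have h₅ := A.inDegree_add_outDegree (A.arc e').1 2
      -- At an AND vertex, losing the blue edge and a red one leaves weight at most one; an OR
      -- vertex has no red edge.
      rcases hG (A.arc e').1 with h | h
      · have := h.1; have := h.2; omega
      · have := h.1; have := h.2; omega
    · rw [← inDegree_ne_zero]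
      have h₃ := h v
      rw [inWeight_eq] at h₃
      have h₄ := A.inDegree_add_outDegree v 1
      have := hv.2
      omega
  · rintro ⟨h₁, h₂⟩ v
    rw [inWeight_eq]
    have h₄ := A.inDegree_add_outDegree v 1
    have h₅ := A.inDegree_add_outDegree v 2
    rcases hG v with h | h
    · have := h.1
      have := h.2
      by_cases ho : A.outDegree 1 v = 0
      · omega
      by_cases ho' : A.outDegree 2 v = 0
      · omega
      obtain ⟨e, he, hv⟩ := (A.outDegree_ne_zero v).1 ho
      obtain ⟨e', he', hv'⟩ := (A.outDegree_ne_zero v).1 ho'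
      exact absurd (hv.trans hv'.symm) (h₁ e e' he he')
    · have := (A.inDegree_ne_zero v).2 (h₂ v h)
      omega

theorem arc_eq_or (B : G.Orientation) (e : Fin G.m) :
    B.arc e = A.arc e ∨ B.arc e = (A.arc e).swap := by
  have h : s((B.arc e).1, (B.arc e).2) = s((A.arc e).1, (A.arc e).2) :=
    (B.ends_arc e).trans (A.ends_arc e).symm
  rcases Sym2.eq_iff.1 h with h | h
  · exact .inl (Prod.ext h.1 h.2)
  · exact .inr (Prod.ext h.1 h.2)

theorem ext_arc {A B : G.Orientation} (h : ∀ e, A.arc e = B.arc e) : A = B := by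
  cases A; cases B
  congr
  exact funext h

end Orientation

/-- Handshake count: three edge ends at each vertex, two for each edge. It bounds loops over darts
in terms of the number of vertices. -/
theorem two_mul_m_le (hG : G.IsAndOr) : 2 * G.m ≤ 3 * G.n := by
  have h₁ : ∀ v, G.degreeOfWeight 1 v + G.degreeOfWeight 2 v = 3 := by
    intro v
    rcases hG v with h | h <;> simp [h.1, h.2]
  have h₂ : ∑ v, (G.degreeOfWeight 1 v + G.degreeOfWeight 2 v) = 3 * G.n := by
    simp [h₁, mul_comm]
  have h₃ : ∀ e : Fin G.m, ∑ v, G.incidence e v = 2 := by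
    intro e
    have : ∃ a b, G.ends e = s(a, b) := by
      induction h : G.ends e with
      | _ a b => exact ⟨a, b, rfl⟩
    obtain ⟨a, b, hab⟩ := this
    have : ∀ v, G.incidence e v = (if b = v then 1 else 0) + (if a = v then 1 else 0) := by
      intro v
      unfold incidence
      rw [hab]
      simp only [Sym2.mem_iff, Sym2.eq_iff]
      by_cases h₁ : a = v <;> by_cases h₂ : b = v <;> simp [h₁, h₂, eq_comm]
    simp [this, Finset.sum_add_distrib]
  rw [← h₂]
  simp only [degreeOfWeight]
  rw [Finset.sum_add_distrib, Finset.sum_comm, Finset.sum_comm (s := Finset.univ (α := Fin G.n)),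
    ← Finset.sum_add_distrib]
  have h₄ : ∀ e : Fin G.m, (∑ v, if G.weight e = 1 then G.incidence e v else 0) +
      (∑ v, if G.weight e = 2 then G.incidence e v else 0) = 2 := by
    intro e
    rcases G.weight_eq e with h | h <;> simp [h, h₃]
  rw [Finset.sum_congr rfl fun e _ => h₄ e]
  simp [mul_comm]

/-! ### Darts as literals -/

namespace Orientation

/-- The darts of the graph: `(e, false)` stands for the edge `e` with its direction in a fixed
orientation, and `(e, true)` for the opposite direction. -/
abbrev Dart (G : ConstraintGraph) := Fin G.m × Bool

variable (A : G.Orientation)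

/-- The arc that belongs to a dart. -/
def dartArc (d : Dart G) : Fin G.n × Fin G.n := if d.2 then (A.arc d.1).swap else A.arc d.1

@[simp] theorem dartArc_false (e : Fin G.m) : A.dartArc (e, false) = A.arc e := rfl

@[simp] theorem dartArc_true (e : Fin G.m) : A.dartArc (e, true) = (A.arc e).swap := rfl

/-- The clause system whose solutions describe the orientations in which no red and blue edge
leave the same vertex. -/
def clauses : ClauseSystem (Dart G) where
  neg d := (d.1, !d.2)
  neg_neg d := by simp
  neg_ne d h := by simpa using congrArg Prod.snd h
  conf d d' := (A.dartArc d).1 = (A.dartArc d').1 ∧ G.weight d.1 ≠ G.weight d'.1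
  conf_symm _ _ h := ⟨h.1.symm, h.2.symm⟩

/-- The blue darts that enter a vertex without red edges. -/
def IsOrDart (d : Dart G) : Prop :=
  G.weight d.1 = 2 ∧ ¬ ∃ d' : Dart G, G.weight d'.1 = 1 ∧ (A.dartArc d').1 = (A.dartArc d).2

/-- Every OR vertex is entered by one of the darts in `U`. -/
def Hits (U : Set (Dart G)) : Prop :=
  ∀ d, A.IsOrDart d → ∃ d' ∈ U, A.IsOrDart d' ∧ (A.dartArc d').2 = (A.dartArc d).2

variable {A} in
-- AND vertices have red edge ends and OR vertices have none. Since `d'` ranges over both directions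
-- of each edge, its tail can be any end of a red edge.
theorem isOrDart_iff (hG : G.IsAndOr) {d : Dart G} :
    A.IsOrDart d ↔ G.weight d.1 = 2 ∧ G.IsOrVertex (A.dartArc d).2 := by
  refine and_congr_right fun hd => ?_
  set v := (A.dartArc d).2
  have h₁ := A.inDegree_add_outDegree v 1
  rw [not_iff_comm]
  constructor
  · intro h
    have h₂ : G.IsAndVertex v := (hG v).resolve_right h
    have := h₂.2
    by_cases h₃ : A.outDegree 1 v = 0
    · have h₄ : A.inDegree 1 v ≠ 0 := by omega
      obtain ⟨e, he, hv⟩ := (A.inDegree_ne_zero v).1 h₄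
      exact ⟨(e, true), he, by simpa using hv⟩
    · obtain ⟨e, he, hv⟩ := (A.outDegree_ne_zero v).1 h₃
      exact ⟨(e, false), he, by simpa using hv⟩
  · rintro ⟨⟨e, b⟩, he, hv⟩ h
    have := h.2
    cases b
    · exact (A.outDegree_ne_zero v).2 ⟨e, he, by simpa using hv⟩ (by omega)
    · exact (A.inDegree_ne_zero v).2 ⟨e, he, by simpa using hv⟩ (by omega)

/-- The set of true darts describes the orientation `B`. -/
structure Represents (σ : Set (Dart G)) (B : G.Orientation) : Prop where
  neg_mem : ∀ d, A.clauses.neg d ∈ σ ↔ d ∉ σ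
  arc_eq : ∀ d ∈ σ, A.dartArc d = B.arc d.1

variable {A} in
theorem Represents.exists_mem {σ : Set (Dart G)} {B : G.Orientation} (h : A.Represents σ B)
    (e : Fin G.m) : ∃ b, (e, b) ∈ σ := by
  by_cases h' : (e, false) ∈ σ
  · exact ⟨_, h'⟩
  · exact ⟨true, (h.neg_mem (e, false)).2 h'⟩

variable {A} in
-- The clauses treat the edges that leave a vertex, `Hits` the OR vertices. `Hits` only concerns
-- vertices that some OR dart enters; feasibility of `A` shows that every OR vertex is one.
theorem Represents.feasible_iff (hG : G.IsAndOr) (hA : A.Feasible) {σ : Set (Dart G)}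
    {B : G.Orientation} (h : A.Represents σ B) :
    B.Feasible ↔ A.clauses.IsSol σ ∧ A.Hits σ := by
  rw [Orientation.feasible_iff B hG]
  constructor
  · rintro ⟨h₁, h₂⟩
    refine ⟨⟨h.neg_mem, ?_⟩, ?_⟩
    · rintro d hd d' hd' ⟨hc, hw⟩
      rw [h.arc_eq d hd, h.arc_eq d' hd'] at hc
      rcases G.weight_eq d.1 with h₃ | h₃ <;> rcases G.weight_eq d'.1 with h₄ | h₄
      · exact hw (h₃.trans h₄.symm)
      · exact h₁ _ _ h₃ h₄ hc
      · exact h₁ _ _ h₄ h₃ hc.symm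
      · exact hw (h₃.trans h₄.symm)
    · intro d hd
      obtain ⟨e, he, hv⟩ := h₂ _ ((isOrDart_iff hG).1 hd).2
      obtain ⟨b, hb⟩ := h.exists_mem e
      have hv' : (A.dartArc (e, b)).2 = (A.dartArc d).2 := by rw [h.arc_eq _ hb]; exact hv
      exact ⟨(e, b), hb, (isOrDart_iff hG).2 ⟨he, by rw [hv']; exact ((isOrDart_iff hG).1 hd).2⟩,
        hv'⟩
  · rintro ⟨h₁, h₂⟩
    refine ⟨fun e e' he he' hee' => ?_, fun v hv => ?_⟩
    · obtain ⟨b, hb⟩ := h.exists_mem e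
      obtain ⟨b', hb'⟩ := h.exists_mem e'
      refine h₁.not_conf _ hb _ hb' ⟨?_, by simp [he, he']⟩
      rw [h.arc_eq _ hb, h.arc_eq _ hb']
      exact hee'
    · obtain ⟨e, he, hev⟩ := ((Orientation.feasible_iff A hG).1 hA).2 v hv
      obtain ⟨d, hd, hd', hdv⟩ := h₂ (e, false) ((isOrDart_iff hG).2 ⟨he, by
        rw [dartArc_false, hev]; exact hv⟩)
      refine ⟨d.1, hd'.1, ?_⟩
      rw [← h.arc_eq d hd, hdv, dartArc_false, hev]

open Classical in
/-- The orientation described by a set of darts. -/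
noncomputable def orient (σ : Set (Dart G)) : G.Orientation where
  arc e := if (e, true) ∈ σ then (A.arc e).swap else A.arc e
  ends_arc e := by
    rw [← A.ends_arc e]
    split_ifs
    · exact Sym2.eq_swap
    · rfl

theorem represents_orient {σ : Set (Dart G)} (h : ∀ d, A.clauses.neg d ∈ σ ↔ d ∉ σ) :
    A.Represents σ (A.orient σ) := by
  refine ⟨h, ?_⟩
  rintro ⟨e, b⟩ hd
  cases b
  · have := (h (e, true)).1 hd
    simp [orient, this]
  · simp [orient, hd]

/-- The darts of an orientation. A loop is always represented by its first dart. -/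
def darts (B : G.Orientation) : Set (Dart G) :=
  {d | A.dartArc d = B.arc d.1 ∧ ((A.arc d.1).1 = (A.arc d.1).2 → d.2 = false)}

/-- The two darts of a loop have the same arc; the second condition in `darts` ensures that only one
of them is true. -/
theorem represents_darts (B : G.Orientation) : A.Represents (A.darts B) B := by
  refine ⟨?_, fun d hd => hd.1⟩
  rintro ⟨e, b⟩
  have h := A.arc_eq_or B e
  have hs : (A.arc e).swap = A.arc e ↔ (A.arc e).1 = (A.arc e).2 := by
    rw [Prod.ext_iff]
    simp only [Prod.fst_swap, Prod.snd_swap]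
    exact ⟨fun h => h.2, fun h => ⟨h.symm, h⟩⟩
  simp only [darts, clauses, Set.mem_ofPred_eq]
  by_cases hl : (A.arc e).1 = (A.arc e).2
  · have := hs.2 hl
    rw [this, or_self] at h
    cases b <;> simp [hl, this, h]
  · have := mt hs.1 hl
    rcases h with h | h <;> cases b <;> simp [hl, h, this, Ne.symm this]

theorem Represents.eq {σ : Set (Dart G)} {B C : G.Orientation} (hB : A.Represents σ B)
    (hC : A.Represents σ C) : B = C := by
  refine ext_arc fun e => ?_
  obtain ⟨b, hb⟩ := hB.exists_mem e
  exact (hB.arc_eq _ hb).symm.trans (hC.arc_eq _ hb)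

theorem mem_darts_self {d : Dart G} : d ∈ A.darts A ↔ d.2 = false := by
  obtain ⟨e, b⟩ := d
  cases b
  · simp [darts]
  · simp only [darts, Set.mem_ofPred_eq, dartArc_true]
    constructor
    · rintro ⟨h, h'⟩
      exact h' (congrArg Prod.snd h)
    · intro h; cases h

/-! ### Rigid darts and the search through sets of darts -/

/-- The rigid darts that are true in `A`. -/
def rigidDarts : Set (Dart G) := {d | d.2 = false ∧ A.clauses.Rigid d}

/-- Some feasible orientation contains the darts in `U` and the rigid darts of `A`, and all
orientations that contain `U` satisfy the OR vertices. -/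
def Valid (U : Set (Dart G)) : Prop := A.Hits U ∧ A.clauses.Consistent (U ∪ A.rigidDarts)

/-- The sets of darts that can be reached from one in `A` by growing and shrinking. -/
inductive Reached : Set (Dart G) → Prop
  | base {U : Set (Dart G)} : (∀ d ∈ U, A.IsOrDart d) → A.Valid U → (∀ d ∈ U, d.2 = false) →
      Reached U
  | step {U V : Set (Dart G)} : Reached U → (∀ d ∈ V, A.IsOrDart d) → A.Valid V →
      (U ⊆ V ∨ V ⊆ U) → Reached V

variable {A}

theorem Reached.valid {U : Set (Dart G)} (h : A.Reached U) : A.Valid U := by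
  cases h <;> assumption

theorem Reached.isOrDart {U : Set (Dart G)} (h : A.Reached U) : ∀ d ∈ U, A.IsOrDart d := by
  cases h <;> assumption

theorem Hits.mono {U V : Set (Dart G)} (h : A.Hits U) (hUV : U ⊆ V) : A.Hits V := by
  intro d hd
  obtain ⟨d', h₁, h₂⟩ := h d hd
  exact ⟨d', hUV h₁, h₂⟩

theorem isSol_darts_self (hG : G.IsAndOr) (hA : A.Feasible) : A.clauses.IsSol (A.darts A) :=
  (((A.represents_darts A).feasible_iff hG hA).1 hA).1

theorem rigidDarts_subset : A.rigidDarts ⊆ A.darts A := fun _ hd => A.mem_darts_self.2 hd.1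

/-- Solutions that contain the rigid darts of `A` agree on all rigid darts. -/
theorem mem_of_rigid {σ τ : Set (Dart G)} (hσ : A.clauses.IsSol σ) (hτ : A.clauses.IsSol τ)
    (hRσ : A.rigidDarts ⊆ σ) (hRτ : A.rigidDarts ⊆ τ) :
    ∀ d ∈ σ, A.clauses.Rigid d → d ∈ τ := by
  intro d hd hr
  by_contra hdτ
  have h₁ := (hτ.neg_mem d).2 hdτ
  obtain ⟨e, b⟩ := d
  cases b
  · exact hdτ (hRτ ⟨rfl, hr⟩)
  · exact (hσ.neg_mem (e, true)).1 (hRσ ⟨rfl, hr.neg⟩) hd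

/-- This includes loops: the flip then changes the solution but not the orientation, as swapping the
arc of a loop has no effect. -/
theorem adjacent_orient_flip {σ : Set (Dart G)} (hσ : A.clauses.IsSol σ) {d : Dart G}
    (hd : d ∈ σ) (hτ : A.clauses.IsSol (A.clauses.flip σ d)) :
    (A.orient σ).Adjacent (A.orient (A.clauses.flip σ d)) := by
  refine .inr ⟨d.1, funext fun e => ?_⟩
  have h₁ := A.represents_orient hσ.neg_mem
  have h₂ := A.represents_orient hτ.neg_mem
  by_cases he : e = d.1
  · subst he
    have h₃ := h₂.arc_eq (A.clauses.neg d) (ClauseSystem.mem_flip.2 (.inl rfl))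
    rw [Function.update_self, ← h₁.arc_eq d hd]
    refine h₃.symm.trans ?_
    obtain ⟨e, b⟩ := d
    cases b <;> simp [clauses]
  · rw [Function.update_of_ne he]
    obtain ⟨b, hb⟩ := h₁.exists_mem e
    have hb' : (e, b) ∈ A.clauses.flip σ d :=
      ClauseSystem.mem_flip.2 (.inr ⟨hb, fun h => he (congrArg Prod.fst h)⟩)
    exact (h₂.arc_eq _ hb').symm.trans (h₁.arc_eq _ hb)

/-- Two solutions with common rigid darts and common darts that satisfy the OR vertices. -/
theorem reconfigurable_orient (hG : G.IsAndOr) (hA : A.Feasible) {σ τ U : Set (Dart G)}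
    (hσ : A.clauses.IsSol σ) (hτ : A.clauses.IsSol τ) (hRσ : A.rigidDarts ⊆ σ)
    (hRτ : A.rigidDarts ⊆ τ) (hU : A.Hits U) (hUσ : U ⊆ σ) (hUτ : U ⊆ τ) :
    (A.orient σ).Reconfigurable (A.orient τ) := by
  have feas : ∀ {ρ}, A.clauses.IsSol ρ → U ⊆ ρ → (A.orient ρ).Feasible := fun h h' =>
    ((A.represents_orient h.neg_mem).feasible_iff hG hA).2 ⟨h, hU.mono h'⟩
  refine ⟨feas hσ hUσ, feas hτ hUτ, ?_⟩
  have h := hτ.connected hUτ hσ hUσ (mem_of_rigid hσ hτ hRσ hRτ)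
  clear hRσ
  induction h using ReflTransGen.head_induction_on with
  | refl => exact .refl
  | head h' _ ih =>
    obtain ⟨hs, hUs, d, hd, rfl⟩ := h'
    exact .head ⟨feas hσ hUσ, feas hs hUs, adjacent_orient_flip hσ hd hs⟩ (ih hs hUs)

theorem Reconfigurable.trans {B C D : G.Orientation} (h : B.Reconfigurable C)
    (h' : C.Reconfigurable D) : B.Reconfigurable D :=
  ⟨h.1, h'.2.1, h.2.2.trans h'.2.2⟩

theorem orient_darts (B : G.Orientation) : A.orient (A.darts B) = B :=
  Represents.eq A (A.represents_orient (A.represents_darts B).neg_mem) (A.represents_darts B)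

/-- If the set grows, solutions for the new set are solutions for the old one. If it shrinks,
consistency of the old set provides a solution `τ` for both, and the new set is common to `τ` and
`σ`. -/
theorem Reached.reconfigurable (hG : G.IsAndOr) (hA : A.Feasible) {U : Set (Dart G)}
    (h : A.Reached U) : ∀ σ, A.clauses.IsSol σ → U ⊆ σ → A.rigidDarts ⊆ σ →
      A.Reconfigurable (A.orient σ) := by
  have hAs := isSol_darts_self hG hA
  induction h with
  | base _ hU hUA =>
    intro σ hσ hUσ hRσ
    have := reconfigurable_orient hG hA hAs hσ rigidDarts_subset hRσ hU.1
      (fun d hd => A.mem_darts_self.2 (hUA d hd)) hUσ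
    rwa [orient_darts] at this
  | step hU _ hV hUV ih =>
    intro σ hσ hVσ hRσ
    rcases hUV with h | h
    · exact ih σ hσ (h.trans hVσ) hRσ
    · obtain ⟨τ, hτ, hUτ⟩ := hU.valid.2.exists_isSol hAs
      rw [Set.union_subset_iff] at hUτ
      exact (ih τ hτ hUτ.1 hUτ.2).trans (reconfigurable_orient hG hA hτ hσ hUτ.2 hRσ
        hV.1 (h.trans hUτ.1) hVσ)

/-- A step between two orientations flips one dart that is not a loop. -/
theorem Adjacent.darts_eq {B C : G.Orientation} (h : B.Adjacent C) : A.darts C = A.darts B ∨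
    ∃ d ∈ A.darts B, (A.dartArc d).1 ≠ (A.dartArc d).2 ∧
      A.darts C = A.clauses.flip (A.darts B) d := by
  rcases h with rfl | ⟨e, he⟩
  · exact .inl rfl
  have hne : ∀ e' ≠ e, C.arc e' = B.arc e' := fun e' h => by rw [he, Function.update_of_ne h]
  have hee : C.arc e = (B.arc e).swap := by rw [he, Function.update_self]
  by_cases hl : (B.arc e).1 = (B.arc e).2
  · left
    congr 1
    refine ext_arc fun e' => ?_
    by_cases h : e' = e
    · subst h
      rw [hee]
      exact Prod.ext hl.symm hl
    · exact hne e' h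
  · right
    have hB := A.represents_darts B
    have hC := A.represents_darts C
    obtain ⟨b, hb⟩ := hB.exists_mem e
    refine ⟨(e, b), hb, by rw [hB.arc_eq _ hb]; exact hl, ?_⟩
    have hlA : (A.arc e).1 ≠ (A.arc e).2 := by
      rcases A.arc_eq_or B e with h | h <;> rw [h] at hl
      · exact hl
      · exact fun h => hl h.symm
    have hswap : (e, !b) ∈ A.darts C := by
      refine ⟨?_, fun h => absurd h hlA⟩
      simp only [hee]
      rw [← hB.arc_eq _ hb]
      cases b <;> simp
    ext ⟨e', b'⟩
    rw [ClauseSystem.mem_flip]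
    by_cases h : e' = e
    · subst h
      constructor
      · intro h'
        left
        by_contra hbb
        have : b' = b := by
          by_contra h''
          exact hbb (by simp only [clauses]; rw [Bool.eq_not_of_ne h''])
        subst this
        exact (hC.neg_mem (e', b')).1 hswap h'
      · rintro (h' | ⟨h', h''⟩)
        · rw [h']; exact hswap
        · have : b' = !b := Bool.eq_not_of_ne fun h => h'' (by rw [h])
          rw [this]; exact hswap
    · simp only [darts, Set.mem_ofPred_eq, hne e' h, clauses, Prod.mk.injEq, h, false_and,
        false_or, Ne, not_false_eq_true, and_true]

/-- Consecutive orientations are linked through their common OR darts. The rigid darts take part in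
the induction because validity of the next sets depends on them. -/
theorem Reconfigurable.reached (hG : G.IsAndOr) (hA : A.Feasible) {B : G.Orientation}
    (h : A.Reconfigurable B) :
    A.Reached {d | A.IsOrDart d ∧ d ∈ A.darts B} ∧ A.rigidDarts ⊆ A.darts B := by
  have sol : ∀ {C : G.Orientation}, C.Feasible → A.clauses.IsSol (A.darts C) ∧
    A.Hits (A.darts C) := fun hC => ((A.represents_darts _).feasible_iff hG hA).1 hC
  have restrict : ∀ {U : Set (Dart G)}, A.Hits U → A.Hits {d | A.IsOrDart d ∧ d ∈ U} := by
    intro U hU d hd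
    obtain ⟨d', h₁, h₂, h₃⟩ := hU d hd
    exact ⟨d', ⟨h₂, h₁⟩, h₂, h₃⟩
  have cons : ∀ {C : G.Orientation} {U : Set (Dart G)}, C.Feasible → A.rigidDarts ⊆ A.darts C →
      U ⊆ A.darts C → A.clauses.Consistent (U ∪ A.rigidDarts) := fun hC hR hU =>
    (sol hC).1.consistent (Set.union_subset hU hR)
  induction h.2.2 with
  | refl =>
    exact ⟨.base (fun d hd => hd.1) ⟨restrict (sol hA).2, cons hA rigidDarts_subset
      fun d hd => hd.2⟩ fun d hd => A.mem_darts_self.1 hd.2, rigidDarts_subset⟩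
  | @tail C D hAC hCD ih =>
    obtain ⟨hC, hD, hadj⟩ := hCD
    obtain ⟨ihr, ihR⟩ := ih ⟨hA, hC, hAC⟩
    rcases Adjacent.darts_eq (A := A) hadj with heq | ⟨d, hd, hl, heq⟩
    · rw [heq]; exact ⟨ihr, ihR⟩
    have hR : A.rigidDarts ⊆ A.darts D := by
      intro a ha
      rw [heq]
      exact ha.2.mem_flip (sol hC).1 hd (heq ▸ (sol hD).1) (ihR ha)
    refine ⟨?_, hR⟩
    set U : Set (Dart G) := {a | A.IsOrDart a ∧ a ∈ A.darts C ∧ a ∈ A.darts D} with hU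
    have hUhits : A.Hits U := by
      intro a ha
      obtain ⟨c, hc, hc₁, hc₂⟩ := (sol hC).2 a ha
      -- If the dart into the vertex is the reversed one, take a dart that enters in `D`. It is not
      -- the opposite dart, since the edge is no loop, so it was already present in `C`.
      by_cases hcd : c = d
      · obtain ⟨c', hc', hc₁', hc₂'⟩ := (sol hD).2 a ha
        have hc'' := hc'
        rw [heq, ClauseSystem.mem_flip] at hc''
        rcases hc'' with rfl | h
        · exfalso
          subst hcd
          apply hl
          rw [hc₂, ← hc₂']
          obtain ⟨e, b⟩ := c
          cases b <;> simp [clauses]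
        · exact ⟨c', ⟨hc₁', h.1, hc'⟩, hc₁', hc₂'⟩
      · exact ⟨c, ⟨hc₁, hc, by rw [heq]; exact ClauseSystem.mem_flip.2 (.inr ⟨hc, hcd⟩)⟩, hc₁, hc₂⟩
    have h₁ : A.Reached U := .step ihr (fun d hd => hd.1)
      ⟨hUhits, cons hC ihR fun a ha => ha.2.1⟩ (.inr fun a ha => ⟨ha.1, ha.2.1⟩)
    exact .step h₁ (fun d hd => hd.1) ⟨restrict (sol hD).2, cons hD hR fun a ha => ha.2⟩
      (.inl fun a ha => ⟨ha.1, ha.2.2⟩)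

/-- If no contradiction follows from some reached set and `X`, then an orientation that contains
the darts in `X` can be reached. -/
theorem Reached.exists_reconfigurable (hG : G.IsAndOr) (hA : A.Feasible) {U X : Set (Dart G)}
    (hU : A.Reached U) (hc : A.clauses.Consistent (U ∪ A.rigidDarts ∪ X)) :
    ∃ σ, X ⊆ σ ∧ A.Represents σ (A.orient σ) ∧ A.Reconfigurable (A.orient σ) := by
  obtain ⟨σ, hσ, h⟩ := hc.exists_isSol (isSol_darts_self hG hA)
  simp only [Set.union_subset_iff] at h
  exact ⟨σ, h.2, A.represents_orient hσ.neg_mem, hU.reconfigurable hG hA σ hσ h.1.1 h.1.2⟩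

theorem Reconfigurable.exists_reached (hG : G.IsAndOr) (hA : A.Feasible) {B : G.Orientation}
    (h : A.Reconfigurable B) {X : Set (Dart G)} (hX : X ⊆ A.darts B) :
    ∃ U, A.Reached U ∧ A.clauses.Consistent (U ∪ A.rigidDarts ∪ X) := by
  obtain ⟨h₁, h₂⟩ := h.reached hG hA
  exact ⟨_, h₁, (((A.represents_darts B).feasible_iff hG hA).1 h.2.1).1.consistent
    (Set.union_subset (Set.union_subset (fun d hd => hd.2) h₂) hX)⟩

/-- There are three darts that enter OR vertices for each OR vertex. -/
theorem card_isOrDart (hG : G.IsAndOr) [DecidablePred A.IsOrDart] :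
    (Finset.univ.filter fun d : Dart G => A.IsOrDart d).card = 3 * G.numOr := by
  have h₁ : ∀ v, G.IsOrVertex v →
      (Finset.univ.filter fun d : Dart G => G.weight d.1 = 2 ∧ (A.dartArc d).2 = v).card = 3 := by
    intro v hv
    -- The first dart of an edge enters `v` iff the edge enters `v` in `A`, the second iff it leaves
    -- `v`; together they count the blue degree.
    rw [← hv.1, ← A.inDegree_add_outDegree, Finset.card_filter, Fintype.sum_prod_type,
      inDegree, outDegree, ← Finset.sum_add_distrib]
    refine Finset.sum_congr rfl fun e _ => ?_
    rw [Fintype.sum_bool, add_comm]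
    rfl
  rw [numOr, Finset.card_eq_sum_card_fiberwise (f := fun d => (A.dartArc d).2)
    (t := Finset.univ.filter fun v => G.IsOrVertex v), Finset.sum_congr rfl (g := fun _ => 3),
    Finset.sum_const, smul_eq_mul, mul_comm]
  · intro v hv
    rw [← h₁ v (by simpa using hv), Finset.filter_filter]
    congr 1
    ext d
    simp only [Finset.mem_filter, Finset.mem_univ, true_and, isOrDart_iff hG]
    constructor
    · rintro ⟨h, h'⟩; exact ⟨h.1, h'⟩
    · rintro ⟨h, rfl⟩; exact ⟨⟨h, by simpa using hv⟩, rfl⟩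
  · intro d hd
    have hd' : A.IsOrDart d := by simpa using hd
    simpa using ((isOrDart_iff hG).1 hd').2

end Orientation

end ConstraintGraph

/-! ### The decision algorithm as an expression -/

namespace RAM.Expr

/-- The expression is true, that is, different from zero. -/
def Holds (e : Expr) (s : State) : Prop := e.eval s ≠ 0

def lt (a b : Expr) : Expr := sub b a

def not (a : Expr) : Expr := sub (const 1) a

def eq (a b : Expr) : Expr := not (add (sub a b) (sub b a))

def and (a b : Expr) : Expr := ite a b (const 0)

def or (a b : Expr) : Expr := ite a (const 1) b

theorem holds_lt {a b : Expr} {s : State} : (lt a b).Holds s ↔ a.eval s < b.eval s := by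
  simp only [Holds, lt, eval]; omega

theorem holds_not {a : Expr} {s : State} : (not a).Holds s ↔ ¬ a.Holds s := by
  simp only [Holds, not, eval]; omega

theorem holds_eq {a b : Expr} {s : State} : (eq a b).Holds s ↔ a.eval s = b.eval s := by
  simp only [Holds, eq, not, eval]; omega

theorem holds_and {a b : Expr} {s : State} : (and a b).Holds s ↔ a.Holds s ∧ b.Holds s := by
  by_cases h : a.eval s = 0 <;> simp [Holds, and, eval, h]

theorem holds_or {a b : Expr} {s : State} : (or a b).Holds s ↔ a.Holds s ∨ b.Holds s := by
  by_cases h : a.eval s = 0 <;> simp [Holds, or, eval, h]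

theorem holds_ex {x N : ℕ} {e : Expr} {s : State} :
    (ex x N e).Holds s ↔ ∃ i < s.reg N, e.Holds (s.setReg x i) := by
  simp [Holds, eval]

theorem holds_reach {x y N : ℕ} {init step z : Expr} {s : State} :
    (reach x y N init step z).Holds s ↔ Reach (s.reg N) (fun i => init.Holds (s.setReg x i))
      (fun i j => step.Holds ((s.setReg y i).setReg x j)) (z.eval s) := by
  simp [Holds, eval]

theorem eval_ite_lt {a b c d : Expr} {s : State} :
    (ite (lt a b) c d).eval s = if a.eval s < b.eval s then c.eval s else d.eval s := by
  by_cases h : a.eval s < b.eval s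
  · rw [eval, if_neg (holds_lt.2 h), if_pos h]
  · rw [eval, if_pos (by_contra fun h' => h (holds_lt.1 h')), if_neg h]

/-! The number of edges `m` is expected in register `1`, the number of darts `2 * m` in register
`3`, and the number of sets of darts that enter OR vertices in register `4`. Darts with numbers
`e < m` represent the arcs of the initial orientation, those with numbers `m + e` the opposite
arcs. The registers `5, …, 21` are loop variables. -/

/-- The number of the edge of the dart `x`. -/
def edgeOf (x : Expr) : Expr := ite (lt x (reg 1)) x (sub x (reg 1))

/-- The tail of the dart `x`. -/
def tail (x : Expr) : Expr := ite (lt x (reg 1)) (arr 0 x) (arr 1 (sub x (reg 1)))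

/-- The head of the dart `x`. -/
def head (x : Expr) : Expr := ite (lt x (reg 1)) (arr 1 x) (arr 0 (sub x (reg 1)))

/-- The weight of the dart `x`. -/
def weightOf (x : Expr) : Expr := arr 2 (edgeOf x)

/-- The dart opposite to `x`. -/
def opp (x : Expr) : Expr := ite (lt x (reg 1)) (add x (reg 1)) (sub x (reg 1))

/-- The dart `x` forces the dart `y`. -/
def imp (x y : Expr) : Expr :=
  and (eq (tail x) (tail (opp y))) (not (eq (weightOf x) (weightOf (opp y))))

/-- The dart in register `k` enters an OR vertex. -/
def isOrDart (k : ℕ) : Expr :=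
  and (eq (weightOf (reg k)) (const 2))
    (not (ex 5 3 (and (eq (weightOf (reg 5)) (const 1)) (eq (tail (reg 5)) (head (reg k))))))

/-- Two to the number of darts that enter OR vertices and precede the content of register `k`. -/
def power (k : ℕ) : Expr :=
  iter 6 7 3 (const 1)
    (ite (and (lt (reg 6) (reg k)) (isOrDart 6)) (add (reg 7) (reg 7)) (reg 7))

/-- The dart in register `k` belongs to the set of darts with the number in register `j`. -/
def mem (j k : ℕ) : Expr :=
  and (isOrDart k) (not (lt
    (iter 8 9 4 (reg j) (ite (lt (reg 9) (add (power k) (power k))) (reg 9)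
      (sub (reg 9) (add (power k) (power k)))))
    (power k)))

/-- The dart in register `k` is rigid and belongs to the initial orientation. -/
def isRigidDart (k : ℕ) : Expr :=
  and (lt (reg k) (reg 1)) (ex 10 3 (and (not (eq (reg 10) (reg k)))
    (and (reach 11 12 3 (eq (reg 11) (reg k)) (imp (reg 12) (reg 11)) (reg 10))
      (reach 11 12 3 (eq (reg 11) (reg 10)) (imp (reg 12) (reg 11)) (reg k)))))

/-- The set of darts in register `13` that is described by `W` is consistent. -/
def consistent (W : Expr) : Expr :=
  not (ex 14 3 (and (reach 13 15 3 W (imp (reg 15) (reg 13)) (reg 14))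
    (reach 13 15 3 W (imp (reg 15) (reg 13)) (opp (reg 14)))))

/-- The set with the number in register `j` contains a dart into each OR vertex. -/
def hits (j : ℕ) : Expr :=
  not (ex 16 3 (and (isOrDart 16)
    (not (ex 17 3 (and (mem j 17) (eq (head (reg 17)) (head (reg 16))))))))

/-- The set with the number in register `j` is valid. -/
def valid (j : ℕ) : Expr :=
  and (hits j) (consistent (or (mem j 13) (isRigidDart 13)))

/-- The set with the number in register `i` is contained in that with the number in `j`. -/
def subset (i j : ℕ) : Expr := not (ex 18 3 (and (mem i 18) (not (mem j 18))))

/-- The set with the number in register `i` is contained in the initial orientation. -/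
def subsetIni (i : ℕ) : Expr := not (ex 18 3 (and (mem i 18) (not (lt (reg 18) (reg 1)))))

/-- The set with the number in register `j` is reached. -/
def reached (j : ℕ) : Expr :=
  reach 19 20 4 (and (valid 19) (subsetIni 19))
    (and (valid 19) (or (subset 20 19) (subset 19 20))) (reg j)

/-- An orientation can be reached that contains the darts in register `13` that are described
by `X`. -/
def answer (X : Expr) : Expr :=
  ex 21 4 (and (reached 21) (consistent (or (or (mem 21 13) (isRigidDart 13)) X)))

end RAM.Expr

/-! ### Correctness of the expressions on single darts -/

namespace ConstraintGraph.Orientation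

open RAM RAM.Expr Relation

variable {G : ConstraintGraph}

/-- The number of a dart. -/
def code (d : Dart G) : ℕ := d.1 + if d.2 then G.m else 0

theorem code_lt (d : Dart G) : code d < 2 * G.m := by
  obtain ⟨e, b⟩ := d
  have := e.2
  cases b <;> simp [code] <;> omega

theorem code_injective : Function.Injective (code (G := G)) := by
  rintro ⟨e, b⟩ ⟨e', b'⟩ h
  have := e.2
  have := e'.2
  cases b <;> cases b' <;> simp [code] at h ⊢ <;> omega

theorem exists_code {i : ℕ} (h : i < 2 * G.m) : ∃ d : Dart G, code d = i := by
  by_cases h' : i < G.m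
  · exact ⟨(⟨i, h'⟩, false), by simp [code]⟩
  · exact ⟨(⟨i - G.m, by omega⟩, true), by simp [code]; omega⟩

/-- The memory describes the graph and the orientation. -/
structure Stored (A : G.Orientation) (s : State) : Prop where
  m_eq : s.reg 1 = G.m
  darts_eq : s.reg 3 = 2 * G.m
  tail_eq : s.arr 0 = ofFin fun e => ((A.arc e).1 : ℕ)
  head_eq : s.arr 1 = ofFin fun e => ((A.arc e).2 : ℕ)
  weight_eq : s.arr 2 = ofFin G.weight

variable {A : G.Orientation} {s : State}

theorem Stored.setReg (h : A.Stored s) {x : ℕ} (hx : 3 < x) (v : ℕ) :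
    A.Stored (s.setReg x v) := by
  obtain ⟨h₁, h₂, h₃, h₄, h₅⟩ := h
  constructor <;> simp_all [show 1 ≠ x by omega, show 3 ≠ x by omega]

theorem ofFin_val {m : ℕ} (f : Fin m → ℕ) (e : Fin m) : ofFin f e = f e := by
  simp [ofFin]

theorem code_lt_iff {d : Dart G} : code d < G.m ↔ d.2 = false := by
  obtain ⟨e, b⟩ := d
  cases b <;> simp [code]

namespace Stored

theorem eval_edgeOf (h : A.Stored s) {x : Expr} {d : Dart G} (hx : x.eval s = code d) :
    (edgeOf x).eval s = d.1 := by
  obtain ⟨e, b⟩ := d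
  have := e.2
  rw [edgeOf, eval_ite_lt]
  simp only [eval, hx, h.m_eq]
  cases b <;> simp [code]

theorem eval_tail (h : A.Stored s) {x : Expr} {d : Dart G} (hx : x.eval s = code d) :
    (tail x).eval s = (A.dartArc d).1 := by
  obtain ⟨e, b⟩ := d
  rw [tail, eval_ite_lt]
  simp only [eval, hx, h.m_eq, h.tail_eq, h.head_eq]
  cases b <;> simp [code, ofFin]

theorem eval_head (h : A.Stored s) {x : Expr} {d : Dart G} (hx : x.eval s = code d) :
    (head x).eval s = (A.dartArc d).2 := by
  obtain ⟨e, b⟩ := d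
  rw [head, eval_ite_lt]
  simp only [eval, hx, h.m_eq, h.tail_eq, h.head_eq]
  cases b <;> simp [code, ofFin]

theorem eval_weight (h : A.Stored s) {x : Expr} {d : Dart G} (hx : x.eval s = code d) :
    (weightOf x).eval s = G.weight d.1 := by
  rw [weightOf, eval, h.eval_edgeOf hx, h.weight_eq, ofFin_val]

theorem eval_opp (h : A.Stored s) {x : Expr} {d : Dart G} (hx : x.eval s = code d) :
    (opp x).eval s = code (A.clauses.neg d) := by
  obtain ⟨e, b⟩ := d
  rw [opp, eval_ite_lt]
  simp only [eval, hx, h.m_eq]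
  cases b <;> simp [code, clauses]

theorem holds_imp (h : A.Stored s) {x y : Expr} {d d' : Dart G} (hx : x.eval s = code d)
    (hy : y.eval s = code d') : (imp x y).Holds s ↔ A.clauses.Imp d d' := by
  rw [imp, holds_and, holds_not, holds_eq, holds_eq, h.eval_tail hx,
    h.eval_tail (h.eval_opp hy), h.eval_weight hx, h.eval_weight (h.eval_opp hy)]
  simp only [Fin.val_inj]
  rfl

theorem holds_ex_dart (h : A.Stored s) {k : ℕ} {e : Expr} :
    (ex k 3 e).Holds s ↔ ∃ d : Dart G, e.Holds (s.setReg k (code d)) := by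
  rw [holds_ex, h.darts_eq]
  constructor
  · rintro ⟨i, hi, h⟩
    obtain ⟨d, rfl⟩ := exists_code hi
    exact ⟨d, h⟩
  · rintro ⟨d, h⟩
    exact ⟨_, code_lt d, h⟩

/-- The numbers below `2 * G.m` are exactly the codes of darts, so the search among numbers is
reachability among darts. -/
theorem holds_reach_dart (h : A.Stored s) {x y : ℕ} {init step z : Expr} {d : Dart G}
    (hz : z.eval s = code d) {W : Set (Dart G)} {T : Dart G → Dart G → Prop}
    (hW : ∀ a, init.Holds (s.setReg x (code a)) ↔ a ∈ W)
    (hT : ∀ a b, step.Holds ((s.setReg y (code a)).setReg x (code b)) ↔ T a b) :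
    (reach x y 3 init step z).Holds s ↔ ∃ w ∈ W, ReflTransGen T w d := by
  rw [holds_reach, hz, h.darts_eq]
  constructor
  · intro hr
    have : ∀ i, Reach (2 * G.m) (fun i => init.Holds (s.setReg x i))
        (fun i j => step.Holds ((s.setReg y i).setReg x j)) i →
        ∀ d : Dart G, code d = i → ∃ w ∈ W, ReflTransGen T w d := by
      intro i hi
      induction hi with
      | base _ h₁ => rintro d rfl; exact ⟨d, (hW d).1 h₁, .refl⟩
      | step h₁ _ h₂ ih =>
        rintro d rfl
        obtain ⟨d', rfl⟩ := exists_code h₁.lt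
        obtain ⟨w, hw, h₃⟩ := ih d' rfl
        exact ⟨w, hw, h₃.tail ((hT _ _).1 h₂)⟩
    exact this _ hr d rfl
  · rintro ⟨w, hw, hr⟩
    clear hz
    induction hr with
    | refl => exact .base (code_lt _) ((hW w).2 hw)
    | tail _ h₁ ih =>
      exact .step ih (code_lt _) ((hT _ _).2 h₁)

theorem holds_isOrDart (h : A.Stored s) {k : ℕ} (hk : k ≠ 5) {d : Dart G}
    (hd : s.reg k = code d) : (isOrDart k).Holds s ↔ A.IsOrDart d := by
  have h₁ : (reg k).eval s = code d := hd
  rw [isOrDart, holds_and, holds_not, holds_eq, h.eval_weight h₁, h.holds_ex_dart, IsOrDart]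
  refine and_congr Iff.rfl (not_congr (exists_congr fun d' => ?_))
  have h₂ : (reg 5).eval (s.setReg 5 (code d')) = code d' := by simp [eval]
  have h₃ : (reg k).eval (s.setReg 5 (code d')) = code d := by simp [eval, hk, hd]
  have h₄ := h.setReg (x := 5) (by omega) (code d')
  rw [holds_and, holds_eq, holds_eq, h₄.eval_weight h₂, h₄.eval_tail h₂, h₄.eval_head h₃]
  simp only [eval, Fin.val_inj]

end Stored

/-! ### Numbering the sets of darts into OR vertices -/

variable (A) in
/-- The number `i` belongs to a dart that enters an OR vertex. -/
def IsOrCode (i : ℕ) : Prop := ∃ d : Dart G, code d = i ∧ A.IsOrDart d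

theorem isOrCode_code {d : Dart G} : A.IsOrCode (code d) ↔ A.IsOrDart d := by
  constructor
  · rintro ⟨d', h, h'⟩
    rwa [← code_injective h]
  · exact fun h => ⟨d, rfl, h⟩

open Classical in
variable (A) in
/-- The number of darts that enter OR vertices and have a number smaller than `i`. -/
noncomputable def rank (i : ℕ) : ℕ := Nat.count A.IsOrCode i

theorem rank_injective {d d' : Dart G} (hd : A.IsOrDart d) (hd' : A.IsOrDart d')
    (h : A.rank (code d) = A.rank (code d')) : d = d' := by
  classical
  exact code_injective (Nat.count_injective (isOrCode_code.2 hd) (isOrCode_code.2 hd')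
    (by simpa [rank] using h))

theorem rank_lt {d : Dart G} (hd : A.IsOrDart d) : A.rank (code d) < A.rank (2 * G.m) := by
  classical
  exact Nat.count_strict_mono (isOrCode_code.2 hd) (code_lt d)

theorem rank_two_mul_m (hG : G.IsAndOr) : A.rank (2 * G.m) = 3 * G.numOr := by
  classical
  rw [← card_isOrDart (A := A) hG, rank, Nat.count_eq_card_filter_range]
  symm
  refine Finset.card_bij (fun d _ => code d) ?_ (fun _ _ _ _ h => code_injective h) ?_
  · intro d hd
    simp only [Finset.mem_filter, Finset.mem_univ, true_and] at hd
    simpa [code_lt] using isOrCode_code.2 hd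
  · intro i hi
    simp only [Finset.mem_filter, Finset.mem_range] at hi
    obtain ⟨d, rfl, hd⟩ := hi.2
    exact ⟨d, by simpa using hd, rfl⟩

variable (A) in
/-- The set of darts with number `j`. -/
def setOf (j : ℕ) : Set (Dart G) := {d | A.IsOrDart d ∧ j.testBit (A.rank (code d))}

/-- Only OR darts receive a bit, at the position given by their rank, so the range of numbers
depends on the OR darts alone. -/
theorem exists_setOf (U : Set (Dart G)) (hU : ∀ d ∈ U, A.IsOrDart d) :
    ∃ j < 2 ^ A.rank (2 * G.m), A.setOf j = U := by
  classical
  let f : Fin (A.rank (2 * G.m)) → Bool := fun r => decide (∃ d ∈ U, A.rank (code d) = r)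
  refine ⟨Nat.ofBits f, Nat.ofBits_lt_two_pow f, ?_⟩
  ext d
  simp only [setOf, Set.mem_ofPred_eq]
  constructor
  · rintro ⟨hd, h⟩
    rw [Nat.testBit_ofBits_lt _ _ (rank_lt hd)] at h
    obtain ⟨d', hd', h⟩ := of_decide_eq_true h
    rwa [← rank_injective (hU _ hd') hd h]
  · intro hd
    refine ⟨hU d hd, ?_⟩
    rw [Nat.testBit_ofBits_lt _ _ (rank_lt (hU d hd))]
    exact decide_eq_true ⟨d, hd, rfl⟩

/-- This form of the bit test needs only repeated subtraction and a comparison, as no division is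
available. -/
theorem testBit_iff_le_mod (j r : ℕ) : j.testBit r ↔ 2 ^ r ≤ j % (2 ^ r + 2 ^ r) := by
  rw [Nat.testBit_eq_decide_div_mod_eq, decide_eq_true_iff]
  have hr : 0 < 2 ^ r := by positivity
  rw [← two_mul, Nat.mul_comm, Nat.mod_mul]
  have h₁ := Nat.mod_lt j hr
  rcases Nat.mod_two_eq_zero_or_one (j / 2 ^ r) with h | h <;> rw [h]
  · simp; exact h₁
  · simp

namespace Stored

theorem eval_power (h : A.Stored s) {k : ℕ} (hk : k ≠ 6) (hk' : k ≠ 7)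
    (hle : s.reg k ≤ 2 * G.m) : (power k).eval s = 2 ^ A.rank (s.reg k) := by
  classical
  -- The loop runs over all darts but doubles only at OR darts that precede the content of `k`,
  -- hence the minimum.
  have key : ∀ i ≤ 2 * G.m, (Nat.rec ((const 1).eval s) (fun i r =>
      (ite (and (lt (reg 6) (reg k)) (isOrDart 6)) (add (reg 7) (reg 7)) (reg 7)).eval
        ((s.setReg 6 i).setReg 7 r)) i : ℕ) = 2 ^ A.rank (min i (s.reg k)) := by
    intro i
    induction i with
    | zero => simp [eval, rank]
    | succ i ih =>
      intro hi
      obtain ⟨d, hd⟩ := exists_code (G := G) (i := i) (by omega)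
      have hs' := (h.setReg (x := 6) (by omega) i).setReg (x := 7) (by omega)
        (2 ^ A.rank (min i (s.reg k)))
      have hc := holds_and (a := lt (reg 6) (reg k)) (b := isOrDart 6)
        (s := (s.setReg 6 i).setReg 7 (2 ^ A.rank (min i (s.reg k))))
      rw [holds_lt, hs'.holds_isOrDart (d := d) (by omega) (by simp [hd])] at hc
      simp only [eval, State.setReg_reg, hk, hk', if_true, if_false,
        show (6 : ℕ) ≠ 7 by omega] at hc
      simp only [ih (by omega)]
      rw [eval]
      simp only [eval, State.setReg_reg, if_true]
      split_ifs with h'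
      · have hc' := mt hc.2 (fun h => h h')
        by_cases hik : i < s.reg k
        · have hnd : ¬ A.IsOrDart d := fun h => hc' ⟨hik, h⟩
          rw [min_eq_left hik.le, min_eq_left (by omega), rank, rank, Nat.count_succ,
            if_neg (by rw [← hd, isOrCode_code]; exact hnd), Nat.add_zero]
        · rw [min_eq_right (by omega), min_eq_right (by omega)]
      · obtain ⟨h₁, h₂⟩ := hc.1 h'
        rw [min_eq_left h₁.le, min_eq_left (by omega), rank, rank, Nat.count_succ,
          if_pos (by rw [← hd, isOrCode_code]; exact h₂), pow_succ, mul_two]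
  rw [power, eval, h.darts_eq, key _ le_rfl, min_eq_right hle]

end Stored

/-! ### Correctness of the expressions on sets of darts -/

variable (A) in
/-- The memory describes the graph and the orientation and bounds the numbers of sets. -/
structure Ready (s : State) : Prop extends A.Stored s where
  sets_eq : s.reg 4 = 2 ^ A.rank (2 * G.m)

theorem Ready.setReg (h : A.Ready s) {x : ℕ} (hx : 4 < x) (v : ℕ) :
    A.Ready (s.setReg x v) :=
  ⟨h.toStored.setReg (by omega) v, by simp [show 4 ≠ x by omega, h.sets_eq]⟩

namespace Ready

/-- The lower bounds on register numbers, here and below, separate the arguments from the loop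
variables of the expressions. -/
theorem holds_mem (h : A.Ready s) {j k : ℕ} (hk : 9 < k) {d : Dart G}
    (hd : s.reg k = code d) (hjs : s.reg j < 2 ^ A.rank (2 * G.m)) :
    (mem j k).Holds s ↔ d ∈ A.setOf (s.reg j) := by
  rw [mem, holds_and, holds_not, holds_lt, h.toStored.holds_isOrDart (by omega) hd, setOf,
    Set.mem_ofPred_eq, testBit_iff_le_mod, not_lt]
  refine and_congr_right fun hor => ?_
  have hw : ∀ i r, (power k).eval ((s.setReg 8 i).setReg 9 r) = 2 ^ A.rank (code d) := by
    intro i r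
    have := ((h.setReg (x := 8) (by omega) i).setReg (x := 9) (by omega) r).toStored.eval_power
      (k := k) (by omega) (by omega)
      (by simpa [show k ≠ 8 by omega, show k ≠ 9 by omega, hd] using (code_lt d).le)
    simpa [show k ≠ 8 by omega, show k ≠ 9 by omega, hd] using this
  have hw' : (power k).eval s = 2 ^ A.rank (code d) := by
    rw [h.toStored.eval_power (by omega) (by omega) (by rw [hd]; exact (code_lt d).le), hd]
  rw [hw', eval, h.sets_eq]
  set w := 2 ^ A.rank (code d) with hwdef
  have hpos : 0 < w + w := by have : 0 < w := by positivity
                              omega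
  simp only [eval_ite_lt]
  simp only [eval, hw, State.setReg_reg, if_true]
  -- Each subtraction removes at least one, and the number of rounds exceeds the content of `j`; so
  -- in the end the value is below `w + w`.
  have key : ∀ i, ∃ r, (Nat.rec (s.reg j)
      (fun _ r => if r < w + w then r else r - (w + w)) i : ℕ) = r ∧
      r % (w + w) = s.reg j % (w + w) ∧ (r < w + w ∨ r + i ≤ s.reg j) := by
    intro i
    induction i with
    | zero => exact ⟨_, rfl, rfl, .inr le_rfl⟩
    | succ i ih =>
      obtain ⟨r, h₁, h₂, h₃⟩ := ih
      refine ⟨_, rfl, ?_⟩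
      simp only [h₁]
      split_ifs with hr
      · exact ⟨h₂, .inl hr⟩
      · refine ⟨?_, .inr (by omega)⟩
        rw [← h₂]
        conv_rhs => rw [← Nat.sub_add_cancel (not_lt.1 hr), Nat.add_mod_right]
  obtain ⟨r, h₁, h₂, h₃⟩ := key (2 ^ A.rank (2 * G.m))
  rw [h₁, ← h₂, Nat.mod_eq_of_lt (by omega)]

theorem holds_isRigidDart (h : A.Stored s) {k : ℕ} (hk : 12 < k) {d : Dart G}
    (hd : s.reg k = code d) : (isRigidDart k).Holds s ↔ d ∈ A.rigidDarts := by
  rw [isRigidDart, holds_and, holds_lt, h.holds_ex_dart]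
  simp only [eval, hd, h.m_eq, code_lt_iff, rigidDarts, Set.mem_ofPred_eq,
    ClauseSystem.Rigid]
  refine and_congr Iff.rfl (exists_congr fun d' => ?_)
  have h' := h.setReg (x := 10) (by omega) (code d')
  have hT : ∀ a b : Dart G, (imp (reg 12) (reg 11)).Holds
      (((s.setReg 10 (code d')).setReg 12 (code a)).setReg 11 (code b)) ↔
        A.clauses.Imp a b := fun a b =>
    ((h'.setReg (x := 12) (by omega) (code a)).setReg (x := 11) (by omega) (code b)).holds_imp
      (by simp [eval]) (by simp [eval])
  rw [holds_and, holds_not, holds_eq, holds_and,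
    h'.holds_reach_dart (d := d') (W := {d}) (T := A.clauses.Imp) (by simp [eval])
      (fun a => by
        rw [holds_eq]
        simp [eval, show k ≠ 11 by omega, show k ≠ 10 by omega, hd, code_injective.eq_iff]) hT,
    h'.holds_reach_dart (d := d) (W := {d'}) (T := A.clauses.Imp)
      (by simp [eval, show k ≠ 10 by omega, hd])
      (fun a => by rw [holds_eq]; simp [eval, code_injective.eq_iff]) hT]
  simp [eval, show k ≠ 10 by omega, hd, code_injective.eq_iff]

theorem holds_consistent (h : A.Stored s) {W : Expr} {V : Set (Dart G)}
    (hW : ∀ i a, W.Holds ((s.setReg 14 i).setReg 13 (code a)) ↔ a ∈ V) :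
    (consistent W).Holds s ↔ A.clauses.Consistent V := by
  rw [consistent, holds_not, h.holds_ex_dart, not_exists, ClauseSystem.Consistent]
  refine forall_congr' fun d => not_congr ?_
  have h' := h.setReg (x := 14) (by omega) (code d)
  have hT : ∀ a b : Dart G, (imp (reg 15) (reg 13)).Holds
      (((s.setReg 14 (code d)).setReg 15 (code a)).setReg 13 (code b)) ↔
        A.clauses.Imp a b := fun a b =>
    ((h'.setReg (x := 15) (by omega) (code a)).setReg (x := 13) (by omega) (code b)).holds_imp
      (by simp [eval]) (by simp [eval])
  have hd : (reg 14).eval (s.setReg 14 (code d)) = code d := by simp [eval]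
  rw [holds_and,
    h'.holds_reach_dart (d := d) (W := V) (T := A.clauses.Imp) hd (hW _) hT,
    h'.holds_reach_dart (d := A.clauses.neg d) (W := V) (T := A.clauses.Imp) (h'.eval_opp hd)
      (hW _) hT]
  rfl

theorem holds_hits (h : A.Ready s) {j : ℕ} (hj : 17 < j)
    (hjs : s.reg j < 2 ^ A.rank (2 * G.m)) :
    (hits j).Holds s ↔ A.Hits (A.setOf (s.reg j)) := by
  rw [hits, holds_not, h.toStored.holds_ex_dart, Hits, not_exists]
  refine forall_congr' fun d => ?_
  have h' := h.setReg (x := 16) (by omega) (code d)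
  rw [holds_and, h'.toStored.holds_isOrDart (by omega) (d := d) (by simp), holds_not,
    h'.toStored.holds_ex_dart, not_and, not_not]
  refine forall_congr' fun hd => exists_congr fun d' => ?_
  have h'' := h'.setReg (x := 17) (by omega) (code d')
  rw [holds_and, holds_eq, h''.holds_mem (d := d') (by omega) (by simp)
      (by simpa [show j ≠ 16 by omega, show j ≠ 17 by omega] using hjs),
    h''.toStored.eval_head (d := d') (by simp [eval]),
    h''.toStored.eval_head (d := d) (by simp [eval]), Fin.val_inj]
  simp only [State.setReg_reg, show j ≠ 16 by omega, show j ≠ 17 by omega, if_false]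
  constructor
  · exact fun ⟨h₁, h₂⟩ => ⟨h₁, h₁.1, h₂⟩
  · exact fun ⟨h₁, _, h₂⟩ => ⟨h₁, h₂⟩

theorem holds_valid (h : A.Ready s) {j : ℕ} (hj : 17 < j)
    (hjs : s.reg j < 2 ^ A.rank (2 * G.m)) :
    (valid j).Holds s ↔ A.Valid (A.setOf (s.reg j)) := by
  rw [valid, holds_and, h.holds_hits hj hjs, Valid]
  refine and_congr Iff.rfl (holds_consistent h.toStored fun i a => ?_)
  have h' := (h.setReg (x := 14) (by omega) i).setReg (x := 13) (by omega) (code a)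
  rw [holds_or, h'.holds_mem (d := a) (by omega) (by simp)
    (by simpa [show j ≠ 13 by omega, show j ≠ 14 by omega] using hjs),
    holds_isRigidDart h'.toStored (d := a) (by omega) (by simp)]
  simp [show j ≠ 13 by omega, show j ≠ 14 by omega]

theorem holds_subset (h : A.Ready s) {i j : ℕ} (hi : 18 < i) (hj : 18 < j)
    (his : s.reg i < 2 ^ A.rank (2 * G.m)) (hjs : s.reg j < 2 ^ A.rank (2 * G.m)) :
    (subset i j).Holds s ↔ A.setOf (s.reg i) ⊆ A.setOf (s.reg j) := by
  rw [subset, holds_not, h.toStored.holds_ex_dart, not_exists]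
  refine forall_congr' fun d => ?_
  have h' := h.setReg (x := 18) (by omega) (code d)
  rw [holds_and, holds_not, h'.holds_mem (d := d) (by omega) (by simp)
      (by simpa [show i ≠ 18 by omega] using his),
    h'.holds_mem (d := d) (by omega) (by simp)
      (by simpa [show j ≠ 18 by omega] using hjs), not_and, not_not]
  simp [show i ≠ 18 by omega, show j ≠ 18 by omega]

theorem holds_subsetIni (h : A.Ready s) {i : ℕ} (hi : 18 < i)
    (his : s.reg i < 2 ^ A.rank (2 * G.m)) :
    (subsetIni i).Holds s ↔ ∀ d ∈ A.setOf (s.reg i), d.2 = false := by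
  rw [subsetIni, holds_not, h.toStored.holds_ex_dart, not_exists]
  refine forall_congr' fun d => ?_
  have h' := h.setReg (x := 18) (by omega) (code d)
  rw [holds_and, holds_not, h'.holds_mem (d := d) (by omega) (by simp)
      (by simpa [show i ≠ 18 by omega] using his), holds_lt, not_and, not_not]
  simp [eval, show i ≠ 18 by omega, h.m_eq, code_lt_iff]

theorem setOf_isOrDart {j : ℕ} : ∀ d ∈ A.setOf j, A.IsOrDart d := fun _ h => h.1

theorem holds_reached (h : A.Ready s) {j : ℕ} (hjs : s.reg j < 2 ^ A.rank (2 * G.m)) :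
    (reached j).Holds s ↔ A.Reached (A.setOf (s.reg j)) := by
  have hinit : ∀ i < 2 ^ A.rank (2 * G.m),
      ((and (valid 19) (subsetIni 19)).Holds (s.setReg 19 i) ↔
        A.Valid (A.setOf i) ∧ ∀ d ∈ A.setOf i, d.2 = false) := by
    intro i hi
    have h' := h.setReg (x := 19) (by omega) i
    rw [holds_and, h'.holds_valid (by omega) (by simpa using hi),
      h'.holds_subsetIni (by omega) (by simpa using hi)]
    simp
  have hstep : ∀ i < 2 ^ A.rank (2 * G.m), ∀ j < 2 ^ A.rank (2 * G.m),
      ((and (valid 19) (or (subset 20 19) (subset 19 20))).Holds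
        ((s.setReg 20 i).setReg 19 j) ↔
        A.Valid (A.setOf j) ∧ (A.setOf i ⊆ A.setOf j ∨ A.setOf j ⊆ A.setOf i)) := by
    intro i hi j hj
    have h' := (h.setReg (x := 20) (by omega) i).setReg (x := 19) (by omega) j
    rw [holds_and, holds_or, h'.holds_valid (by omega) (by simpa using hj),
      h'.holds_subset (by omega) (by omega) (by simpa using hi) (by simpa using hj),
      h'.holds_subset (by omega) (by omega) (by simpa using hj) (by simpa using hi)]
    simp
  rw [Expr.reached, holds_reach, h.sets_eq]
  simp only [eval]
  generalize s.reg j = k at hjs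
  constructor
  · intro hr
    induction hr with
    | base h₁ h₂ =>
      obtain ⟨h₃, h₄⟩ := (hinit _ h₁).1 h₂
      exact .base setOf_isOrDart h₃ h₄
    | step h₁ h₂ h₃ ih =>
      obtain ⟨h₄, h₅⟩ := (hstep _ h₁.lt _ h₂).1 h₃
      exact .step (ih h₁.lt) setOf_isOrDart h₄ h₅
  · intro hr
    generalize hU : A.setOf k = U at hr
    induction hr generalizing k with
    | base _ h₁ h₂ =>
      subst hU
      exact .base hjs ((hinit _ hjs).2 ⟨h₁, h₂⟩)
    | step h₀ _ h₁ h₂ ih =>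
      -- A reached set consists of OR darts and therefore has a number.
      obtain ⟨i, hi, rfl⟩ := exists_setOf _ h₀.isOrDart
      subst hU
      exact .step (ih i hi rfl) hjs ((hstep _ hi _ hjs).2 ⟨h₁, h₂⟩)

theorem holds_answer (h : A.Ready s) {X : Expr} {V : Set (Dart G)}
    (hX : ∀ i j a, X.Holds (((s.setReg 21 i).setReg 14 j).setReg 13 (code a)) ↔ a ∈ V) :
    (answer X).Holds s ↔
      ∃ U, A.Reached U ∧ A.clauses.Consistent (U ∪ A.rigidDarts ∪ V) := by
  have key : ∀ k < 2 ^ A.rank (2 * G.m),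
      ((and (Expr.reached 21) (consistent (or (or (mem 21 13) (isRigidDart 13)) X))).Holds
        (s.setReg 21 k) ↔ A.Reached (A.setOf k) ∧
          A.clauses.Consistent (A.setOf k ∪ A.rigidDarts ∪ V)) := by
    intro k hk
    have h' := h.setReg (x := 21) (by omega) k
    rw [holds_and, h'.holds_reached (by simpa using hk)]
    refine and_congr (by simp) (holds_consistent h'.toStored fun i a => ?_)
    have h'' := (h'.setReg (x := 14) (by omega) i).setReg (x := 13) (by omega) (code a)
    rw [holds_or, holds_or, h''.holds_mem (d := a) (by omega) (by simp)
      (by simpa using hk), holds_isRigidDart h''.toStored (d := a) (by omega) (by simp), hX]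
    simp
  rw [answer, holds_ex, h.sets_eq]
  constructor
  · rintro ⟨k, hk, hr⟩
    exact ⟨_, (key k hk).1 hr⟩
  · rintro ⟨U, hU, hc⟩
    obtain ⟨k, hk, rfl⟩ := exists_setOf _ hU.isOrDart
    exact ⟨k, hk, (key k hk).2 ⟨hU, hc⟩⟩

end Ready

end ConstraintGraph.Orientation

/-! ### The algorithms for the two problems -/

namespace RAM

open RAM.Expr

/-- Compute the numbers of darts and of sets of darts, then evaluate the expression. -/
def decisionProgram (X : Expr) : Prog :=
  .seq (.add 3 1 1) (.seq ((power 3).compile 30) (.seq (.copy 4 30)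
    (.seq ((answer X).compile 30) (.copy 0 30))))

open Polynomial in
/-- A bound on the running time of `decisionProgram` in terms of the length of the loops. -/
noncomputable def decisionCost (X : Expr) : ℕ[X] :=
  1 + ((power 3).cost + (1 + ((answer X).cost + 1)))

/-- Each monomial gains a power of `a` with exponent at most the degree. This separates the
exponential factor from the polynomial one. -/
theorem eval_mul_le (p : Polynomial ℕ) {a : ℕ} (ha : 1 ≤ a) (b : ℕ) :
    p.eval (a * b) ≤ a ^ p.natDegree * p.eval b := by
  rw [Polynomial.eval_eq_sum_range, Polynomial.eval_eq_sum_range, Finset.mul_sum]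
  refine Finset.sum_le_sum fun i hi => ?_
  have hi' : i ≤ p.natDegree := by simpa [Nat.lt_succ_iff] using hi
  calc p.coeff i * (a * b) ^ i = a ^ i * (p.coeff i * b ^ i) := by rw [mul_pow]; ring
    _ ≤ a ^ p.natDegree * (p.coeff i * b ^ i) :=
      Nat.mul_le_mul_right _ (Nat.pow_le_pow_right ha hi')

end RAM

/-! ### Correctness and running time of the program -/

namespace ConstraintGraph.Orientation

open RAM RAM.Expr

variable {G : ConstraintGraph} {A : G.Orientation}

/-- The program decides in time `2 ^ O(k) * poly(n)` whether an orientation can be reached that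
contains the darts described by `X`. -/
theorem runs_decisionProgram {X : Expr} (hwf : X.wf [3, 4] 30 = true) (hG : G.IsAndOr)
    {s : State} (h₁ : s.reg 1 = G.m)
    (h₂ : s.arr 0 = ofFin fun e => ((A.arc e).1 : ℕ))
    (h₃ : s.arr 1 = ofFin fun e => ((A.arc e).2 : ℕ)) (h₄ : s.arr 2 = ofFin G.weight)
    {V : Set (Dart G)}
    (hX : ∀ s', A.Stored s' → s'.reg 2 = s.reg 2 → s'.arr 3 = s.arr 3 → s'.arr 4 = s.arr 4 →
      ∀ a, s'.reg 13 = code a → (X.Holds s' ↔ a ∈ V)) :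
    Runs (decisionProgram X) s
      (2 ^ (3 * (decisionCost X).natDegree * G.numOr) *
        ((decisionCost X).comp (3 * Polynomial.X + 1)).eval G.n) fun s' =>
      ((∃ U, A.Reached U ∧ A.clauses.Consistent (U ∪ A.rigidDarts ∪ V)) → s'.reg 0 = 1) ∧
      ((¬ ∃ U, A.Reached U ∧ A.clauses.Consistent (U ∪ A.rigidDarts ∪ V)) → s'.reg 0 = 0) := by
  -- A common bound for both loop lengths, in product form so that `eval_mul_le` applies.
  set B := 2 ^ (3 * G.numOr) * (3 * G.n + 1) with hB
  have hpow : 1 ≤ 2 ^ (3 * G.numOr) := Nat.one_le_two_pow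
  have hm : 2 * G.m ≤ B := by
    have := two_mul_m_le hG
    have := Nat.mul_le_mul_right (3 * G.n + 1) hpow
    omega
  have hP : 2 ^ A.rank (2 * G.m) ≤ B := by
    rw [rank_two_mul_m hG, hB]
    exact Nat.le_mul_of_pos_right _ (by omega)
  refine Runs.mono (C := (decisionCost X).eval B) ?_ ?_ fun _ h => h
  swap
  · refine (eval_mul_le _ hpow _).trans (le_of_eq ?_)
    rw [← pow_mul, Polynomial.eval_comp]
    simp only [Polynomial.eval_add, Polynomial.eval_mul, Polynomial.eval_ofNat,
      Polynomial.eval_X, Polynomial.eval_one]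
    congr 2
    ring
  simp only [decisionCost, Polynomial.eval_add, Polynomial.eval_one]
  refine Runs.seq (Q := fun s' => s' = s.setReg 3 (2 * G.m)) (Runs.add (by rw [h₁, two_mul])) ?_
  rintro _ rfl
  set s₁ := s.setReg 3 (2 * G.m) with hs₁
  have hst₁ : A.Stored s₁ := ⟨by simp [hs₁, h₁], by simp [hs₁], h₂, h₃, h₄⟩
  -- Register `4` is not set yet, but this expression only loops over darts. With register `3` also
  -- as argument, it counts all OR darts.
  refine (runs_compile (R := [3]) (B := B) (power 3) (by decide) (by simp [hs₁, hm])).seq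
    fun s₂ ⟨hv, hS⟩ => ?_
  rw [hst₁.eval_power (by omega) (by omega) hst₁.darts_eq.le, hst₁.darts_eq] at hv
  refine Runs.seq (Q := fun s' => s' = s₂.setReg 4 (2 ^ A.rank (2 * G.m)))
    (Runs.copy (by rw [hv])) ?_
  rintro _ rfl
  set s₃ := s₂.setReg 4 (2 ^ A.rank (2 * G.m)) with hs₃
  have hreg : ∀ r < 30, s₂.reg r = s₁.reg r := fun r hr => (hS r hr hr.ne).1
  have harr : ∀ r < 30, s₂.arr r = s₁.arr r := fun r hr => (hS r hr hr.ne).2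
  have hready : A.Ready s₃ :=
    { m_eq := by simp [hs₃, hreg, hst₁.m_eq]
      darts_eq := by simp [hs₃, hreg, hst₁.darts_eq]
      tail_eq := by simp [hs₃, harr, hst₁.tail_eq]
      head_eq := by simp [hs₃, harr, hst₁.head_eq]
      weight_eq := by simp [hs₃, harr, hst₁.weight_eq]
      sets_eq := by simp [hs₃] }
  -- As `X` is arbitrary, the closed parts are checked by evaluation and then assembled.
  have hwf' : (answer X).wf [3, 4] 30 = true := by
    have h₁ : (Expr.reached 21).wf [3, 4] 30 = true := by decide +kernel
    have h₂ : (Expr.or (mem 21 13) (isRigidDart 13)).wf [3, 4] 30 = true := by decide +kernel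
    have h₃ : (imp (reg 15) (reg 13)).wf [3, 4] 30 = true := by decide
    have h₄ : (opp (reg 14)).wf [3, 4] 30 = true := by decide
    have h₅ : ∀ a b, a.wf [3, 4] 30 = true → b.wf [3, 4] 30 = true →
        (Expr.or a b).wf [3, 4] 30 = true := fun a b h h' => by simp [Expr.or, wf, h, h']
    simp [answer, Expr.and, Expr.not, consistent, wf, h₁, h₅ _ _ h₂ hwf, h₃, h₄]
  refine (runs_compile (R := [3, 4]) (B := B) (answer X) hwf' ?_).seq fun s₄ ⟨hv₄, _⟩ => ?_
  · simp [hready.darts_eq, hready.sets_eq, hm, hP]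
  have hans := hready.holds_answer (X := X) (V := V) fun i j a => by
    refine hX _ (((hready.setReg (x := 21) (by omega) i).setReg (x := 14) (by omega) j).setReg
      (x := 13) (by omega) (code a)).toStored ?_ ?_ ?_ a (by simp)
    · simp [hs₃, hreg, hs₁]
    · simp [hs₃, harr, hs₁]
    · simp [hs₃, harr, hs₁]
  refine Runs.copy ⟨fun h => ?_, fun h => ?_⟩
  · have h' := hans.2 h
    simp only [State.setReg_reg, if_true, hv₄]
    rw [Holds] at h'
    -- The answer is an existential expression, with value zero or one, so nonzero means one.
    rw [answer, eval] at h' ⊢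
    split_ifs at h' ⊢
    · rfl
    · exact absurd rfl h'
  · have h' := mt hans.1 h
    simpa [Holds, hv₄] using h'

end ConstraintGraph.Orientation

/-! ### The final tests for the two problems -/

namespace RAM.Expr

/-- The dart in register `13` belongs to the target orientation. -/
def isTargetDart : Expr :=
  and (or (lt (reg 13) (reg 1)) (not (eq (tail (reg 13)) (head (reg 13)))))
    (and (eq (tail (reg 13)) (arr 3 (edgeOf (reg 13))))
      (eq (head (reg 13)) (arr 4 (edgeOf (reg 13)))))

/-- The dart in register `13` is opposite to the edge in register `2`, or both darts of this edge
if it is a loop. -/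
def isReversedEdge : Expr :=
  and (eq (edgeOf (reg 13)) (reg 2))
    (or (not (lt (reg 13) (reg 1))) (eq (tail (reg 13)) (head (reg 13))))

end RAM.Expr

open RAM RAM.Expr ConstraintGraph ConstraintGraph.Orientation

theorem C2C.decidesInTime : (decisionProgram isTargetDart).DecidesInTime C2C.input
    (fun I => I.G.IsAndOr) C2C.IsYes
    (fun I => 2 ^ (3 * (decisionCost isTargetDart).natDegree * I.G.numOr) *
      ((decisionCost isTargetDart).comp (3 * Polynomial.X + 1)).eval I.G.n) := by
  intro I hG
  have hrun := runs_decisionProgram (A := I.ini) (X := isTargetDart) (by decide) hG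
    (s := I.input) rfl rfl rfl rfl (V := I.ini.darts I.tar) (by
      intro s hs _ h₃ h₄ a ha
      have ha' : (reg 13).eval s = code a := ha
      have e₃ : (arr 3 (edgeOf (reg 13))).eval s = (I.tar.arc a.1).1 := by
        rw [eval, hs.eval_edgeOf ha', h₃]
        exact ofFin_val (fun e => ((I.tar.arc e).1 : ℕ)) a.1
      have e₄ : (arr 4 (edgeOf (reg 13))).eval s = (I.tar.arc a.1).2 := by
        rw [eval, hs.eval_edgeOf ha', h₄]
        exact ofFin_val (fun e => ((I.tar.arc e).2 : ℕ)) a.1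
      rw [isTargetDart, holds_and, holds_or, holds_lt, holds_not, holds_eq, holds_and, holds_eq,
        holds_eq, e₃, e₄, hs.eval_tail ha', hs.eval_head ha', ha']
      simp only [eval, hs.m_eq, code_lt_iff, Fin.val_inj, darts, Set.mem_ofPred_eq]
      rw [and_comm, Prod.ext_iff]
      have : (I.ini.dartArc a).1 = (I.ini.dartArc a).2 ↔
          (I.ini.arc a.1).1 = (I.ini.arc a.1).2 := by
        obtain ⟨e, b⟩ := a
        cases b <;> simp [eq_comm]
      rw [this]
      tauto)
  obtain ⟨t, s', h₁, h₂, h₃, h₄⟩ := hrun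
  have key : (∃ U, I.ini.Reached U ∧ I.ini.clauses.Consistent
      (U ∪ I.ini.rigidDarts ∪ I.ini.darts I.tar)) ↔ I.IsYes := by
    constructor
    · rintro ⟨U, hU, hc⟩
      obtain ⟨σ, hσ, hr, hB⟩ := hU.exists_reconfigurable hG I.ini_feasible hc
      -- `σ` contains a dart of the target for every edge, which determines all arcs.
      have : I.ini.orient σ = I.tar := by
        refine ext_arc fun e => ?_
        obtain ⟨b, hb⟩ := (I.ini.represents_darts I.tar).exists_mem e
        rw [← (I.ini.represents_darts I.tar).arc_eq _ hb, hr.arc_eq _ (hσ hb)]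
      rwa [this] at hB
    · intro h
      exact Reconfigurable.exists_reached hG I.ini_feasible h subset_rfl
  rw [key] at h₃ h₄
  exact ⟨t, s', h₁, h₂, h₃, h₄⟩

theorem C2E.decidesInTime : (decisionProgram isReversedEdge).DecidesInTime C2E.input
    (fun I => I.G.IsAndOr) C2E.IsYes
    (fun I => 2 ^ (3 * (decisionCost isReversedEdge).natDegree * I.G.numOr) *
      ((decisionCost isReversedEdge).comp (3 * Polynomial.X + 1)).eval I.G.n) := by
  intro I hG
  -- For a loop both darts are demanded; they are complementary, so the test fails, as it should for
  -- an edge with a single direction.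
  set V : Set (Dart I.G) := {a | a.1 = I.edge ∧
    (a.2 = true ∨ (I.ini.arc a.1).1 = (I.ini.arc a.1).2)} with hV
  have hrun := runs_decisionProgram (A := I.ini) (X := isReversedEdge) (by decide) hG
    (s := I.input) rfl rfl rfl rfl (V := V) (by
      intro s hs h₂ _ _ a ha
      have ha' : (reg 13).eval s = code a := ha
      have e₂ : (reg 2).eval s = I.edge := h₂
      have hl : (I.ini.dartArc a).1 = (I.ini.dartArc a).2 ↔
          (I.ini.arc a.1).1 = (I.ini.arc a.1).2 := by
        obtain ⟨e, b⟩ := a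
        cases b <;> simp [eq_comm]
      rw [isReversedEdge, holds_and, holds_or, holds_not, holds_lt, holds_eq, holds_eq, e₂,
        hs.eval_tail ha', hs.eval_head ha', hs.eval_edgeOf ha', ha']
      simp only [eval, hs.m_eq, code_lt_iff, Fin.val_inj, hl, hV, Set.mem_ofPred_eq,
        Bool.not_eq_false])
  obtain ⟨t, s', h₁, h₂, h₃, h₄⟩ := hrun
  have hs : (I.ini.arc I.edge).swap = I.ini.arc I.edge →
      (I.ini.arc I.edge).1 = (I.ini.arc I.edge).2 := fun h => congrArg Prod.snd h
  have key : (∃ U, I.ini.Reached U ∧ I.ini.clauses.Consistent (U ∪ I.ini.rigidDarts ∪ V)) ↔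
      I.IsYes := by
    constructor
    · rintro ⟨U, hU, hc⟩
      obtain ⟨σ, hσ, hr, hB⟩ := hU.exists_reconfigurable hG I.ini_feasible hc
      refine ⟨_, hB.2.1, hB, fun h => ?_⟩
      have h₅ : (I.edge, true) ∈ σ := hσ ⟨rfl, .inl rfl⟩
      rw [← hr.arc_eq _ h₅] at h
      -- An unchanged arc would make the edge a loop, and then `V` contains the complementary dart
      -- as well.
      have h₆ : (I.edge, false) ∈ σ := hσ ⟨rfl, .inr (hs h)⟩
      exact (hr.neg_mem (I.edge, false)).1 h₅ h₆
    · rintro ⟨B, -, hB, hne⟩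
      refine Reconfigurable.exists_reached hG I.ini_feasible hB ?_
      have hBs := (I.ini.arc_eq_or B I.edge).resolve_left hne
      have hl : (I.ini.arc I.edge).1 ≠ (I.ini.arc I.edge).2 := fun h =>
        hne (hBs.trans (Prod.ext h.symm h))
      rintro ⟨e, b⟩ ⟨he, hb⟩
      obtain rfl : e = I.edge := he
      obtain rfl : b = true := hb.resolve_right hl
      exact ⟨hBs.symm, fun h => absurd h hl⟩
  rw [key] at h₃ h₄
  exact ⟨t, s', h₁, h₂, h₃, h₄⟩

theorem theorem1 :
    (∃ (p : RAM.Prog) (c : ℕ) (q : Polynomial ℕ),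
      p.DecidesInTime C2C.input (fun I => I.G.IsAndOr) C2C.IsYes
        (fun I => 2 ^ (c * I.G.numOr) * q.eval I.G.n)) ∧
    (∃ (p : RAM.Prog) (c : ℕ) (q : Polynomial ℕ),
      p.DecidesInTime C2E.input (fun I => I.G.IsAndOr) C2E.IsYes
        (fun I => 2 ^ (c * I.G.numOr) * q.eval I.G.n)) :=
  ⟨⟨_, _, _, C2C.decidesInTime⟩, ⟨_, _, _, C2E.decidesInTime⟩⟩
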